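/- Let $k$ be a field, $d\ge 1$, and let $L_1,\dots,L_n$ be hyperplanes in $\mathbb P^d=\mathbb P^d_k$, where $L_i$ is the zero locus of $\ell_i(\mathbf T)=\sum_{j=0}^d\lambda_{i,j}T_j$ with $\lambda_{i,j}\in k$. Assume that they are in general position: the intersection of any $m$ of them has codimension $m$ in $\mathbb P^d$, or is empty if $m>d$. Let $p_1,\dots,p_n$ be positive integers. Write $\mathcal O=\mathcal O_{\mathbb P^d}$. Let $\Lambda=\Lambda_1\otimes_{\mathcal O}\cdots\otimes_{\mathcal O}\Lambda_n$, where $\Lambda_i\subseteq M_{p_i}(\mathcal O)$ is the sheaf of matrices whose entries strictly above the diagonal lie in the ideal sheaf $\mathcal O(-L_i)$ of $L_i$. Let $L=\Lambda\otimes_{\mathcal O}\mathcal O(1)$, a $\Lambda$-bimodule, and let $$B(\Lambda,L)=\bigoplus_{\ell\ge 0}H^0\bigl(\mathbb P^d,L^{\otimes_\Lambda \ell}\bigr),$$ a $\mathbb Z$-graded $k$-algebra (zero in negative degrees) under the tensor product of sections. Let $\mathbb L$ be the abelian group generated by $\vec x_1,\dots,\vec x_n,\vec c$ with relations $p_i\vec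 x_i=\vec c$, and let $R=k[T_0,\dots,T_d,X_1,\dots,X_n]/(X_i^{p_i}-\ell_i(\mathbf T)\mid 1\le i\le n)$, which is $\mathbb L$-graded by $\deg T_j=\vec c$, $\deg X_i=\vec x_i$. Let $I=\{\sum_{i} a_i\vec x_i\mid 0\le a_i\le p_i-1\}$, a complete set of representatives of $\mathbb L/\mathbb Z\vec c$, and let $$R^{[\mathbb Z\vec c]}=\bigoplus_{m\in\mathbb Z}\bigl(R_{x-y+m\vec c}\bigr)_{x,y\in I}$$ with the multiplication given by matrix multiplication, graded by $\mathbb Z\vec c\simeq\mathbb Z$, $m\vec c\leftrightarrow m$. Then there is an isomorphism of $\mathbb Z$-graded $k$-algebras $B(\Lambda,L)\simeq R^{[\mathbb Z\vec c]}$. -/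

import Mathlib

open TopologicalSpace TopCat CategoryTheory AlgebraicGeometry
open scoped TensorProduct DirectSum

noncomputable section

universe u

namespace GLOrder

/-! ### Triangular orders and tensor rings -/

/-- The ring `T_p(R, I)` of `p × p` matrices over `R` whose entries strictly above the diagonal lie
in the ideal `I`. -/
def triangular (R : Type u) [CommRing R] (I : Ideal R) (p : ℕ) :
    Subalgebra R (Matrix (Fin p) (Fin p) R) where
  carrier := {M | ∀ a b, a < b → M a b ∈ I}
  add_mem' hM hN a b h := I.add_mem (hM a b h) (hN a b h)
  mul_mem' {M N} hM hN a b h := by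
    rw [Matrix.mul_apply]
    refine I.sum_mem fun c _ => ?_
    rcases lt_or_ge a c with hc | hc
    · exact I.mul_mem_right _ (hM a c hc)
    · exact I.mul_mem_left _ (hN c b (hc.trans_lt h))
  algebraMap_mem' r a b h := by
    rw [Matrix.algebraMap_matrix_apply, if_neg h.ne]
    exact I.zero_mem

section TensorRing

open MulOpposite

variable (k Λ L : Type u) [Field k] [Ring Λ] [Algebra k Λ] [AddCommGroup L] [Module k L]
  [Module Λ L] [Module Λᵐᵒᵖ L]

/-- The relations defining the tensor ring of a `Λ`-bimodule `L` (a left `Λ`-module that is also a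
right `Λ`-module, i.e. a module over `Λᵐᵒᵖ`), imposed on the free `k`-algebra on the `k`-module
`Λ × L`: the product and unit of `Λ`, and the left and right actions of `Λ` on `L`. -/
inductive TensorRingRel : TensorAlgebra k (Λ × L) → TensorAlgebra k (Λ × L) → Prop
  | one : TensorRingRel (TensorAlgebra.ι k ((1, 0) : Λ × L)) 1
  | mul (a b : Λ) : TensorRingRel (TensorAlgebra.ι k ((a * b, 0) : Λ × L))
      (TensorAlgebra.ι k ((a, 0) : Λ × L) * TensorAlgebra.ι k ((b, 0) : Λ × L))
  | left (a : Λ) (m : L) : TensorRingRel (TensorAlgebra.ι k ((0, a • m) : Λ × L))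
      (TensorAlgebra.ι k ((a, 0) : Λ × L) * TensorAlgebra.ι k ((0, m) : Λ × L))
  | right (m : L) (a : Λ) : TensorRingRel (TensorAlgebra.ι k ((0, op a • m) : Λ × L))
      (TensorAlgebra.ι k ((0, m) : Λ × L) * TensorAlgebra.ι k ((a, 0) : Λ × L))

/-- The tensor ring `T_Λ(L) = Λ ⊕ L ⊕ (L ⊗_Λ L) ⊕ ⋯` of a bimodule `L` over a (noncommutative)
`k`-algebra `Λ`, presented by generators and relations: algebra maps out of it are pairs of an
algebra map out of `Λ` and a compatible map of bimodules out of `L`. The tensor power `L^{⊗_Λ l}`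
is its degree `l` part, spanned by the elements `a * m₁ * ⋯ * m_l` with `a` in `Λ` and `mᵢ` in `L`,
and `m₁ ⊗ ⋯ ⊗ m_l` is the product `m₁ * ⋯ * m_l`. -/
def TensorRing : Type u := RingQuot (TensorRingRel k Λ L)

instance : Ring (TensorRing k Λ L) := inferInstanceAs (Ring (RingQuot (TensorRingRel k Λ L)))

instance : Algebra k (TensorRing k Λ L) :=
  inferInstanceAs (Algebra k (RingQuot (TensorRingRel k Λ L)))

namespace TensorRing

/-- The universal linear map from `Λ × L` to the tensor ring. -/
def ofPair : Λ × L →ₗ[k] TensorRing k Λ L :=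
  (RingQuot.mkAlgHom k (TensorRingRel k Λ L)).toLinearMap ∘ₗ TensorAlgebra.ι k

/-- The inclusion `Λ → T_Λ(L)` of degree `0`. -/
def ofRing : Λ →ₐ[k] TensorRing k Λ L :=
  AlgHom.ofLinearMap (ofPair k Λ L ∘ₗ LinearMap.inl k Λ L)
    ((RingQuot.mkAlgHom_rel k TensorRingRel.one).trans (map_one _))
    (fun a b => (RingQuot.mkAlgHom_rel k (TensorRingRel.mul a b)).trans (map_mul _ _ _))

/-- The inclusion `L → T_Λ(L)` of degree `1`. -/
def ofModule : L →ₗ[k] TensorRing k Λ L := ofPair k Λ L ∘ₗ LinearMap.inr k Λ L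

variable {Λ L}

theorem ofModule_smul (a : Λ) (m : L) :
    ofModule k Λ L (a • m) = ofRing k Λ L a * ofModule k Λ L m :=
  (RingQuot.mkAlgHom_rel k (TensorRingRel.left a m)).trans (map_mul _ _ _)

theorem ofModule_op_smul (m : L) (a : Λ) :
    ofModule k Λ L (op a • m) = ofModule k Λ L m * ofRing k Λ L a :=
  (RingQuot.mkAlgHom_rel k (TensorRingRel.right m a)).trans (map_mul _ _ _)

end TensorRing

end TensorRing


/-! ### Sheaves of dependent functions

As for the structure sheaf of `Proj` in Mathlib, a sheaf with stalks `M x` is given by its sections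
over `U`, which are families of germs `f x ∈ M x`, `x ∈ U`. Sheafifying means allowing the
families that are locally of the prescribed form. -/

section SubPresheaf

variable (k : Type u) [Field k] {X : TopCat.{u}} (M : X → Type u)
  [∀ x, AddCommGroup (M x)] [∀ x, Module k (M x)]

/-- A presheaf of `k`-vector spaces whose sections over `U` are families of elements of `M x`, for
`x ∈ U`. -/
structure SubPresheaf where
  sec : ∀ U : Opens X, Submodule k (∀ x : U, M x.1)
  res : ∀ {U V : Opens X} (i : U ⟶ V) (f : ∀ x : V, M x.1), f ∈ sec V →
    (fun x : U => f (i x)) ∈ sec U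

variable {k M}

namespace SubPresheaf

/-- The underlying predicate on families. -/
def toPrelocal (S : SubPresheaf k M) : PrelocalPredicate M where
  pred {U} f := f ∈ S.sec U
  res i f h := S.res i f h

/-- The associated sheaf: the families which are locally sections of `S`. -/
def sheafify (S : SubPresheaf k M) : SubPresheaf k M where
  sec U :=
    { carrier := {f | S.toPrelocal.sheafify.pred f}
      zero_mem' := PrelocalPredicate.sheafifyOf (P := S.toPrelocal) (S.sec U).zero_mem
      add_mem' := fun ha hb =>
        PrelocalPredicate.sheafify_inductionOn₂' S.toPrelocal S.toPrelocal S.toPrelocal (· + ·)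
          (fun {U V a b} ha hb => (S.sec (U ⊓ V)).add_mem
            (S.res (Opens.infLELeft U V) a ha) (S.res (Opens.infLERight U V) b hb)) ha hb
      smul_mem' := fun c _ hf =>
        PrelocalPredicate.sheafify_inductionOn' S.toPrelocal (c • ·)
          (fun {U _} ha => (S.sec U).smul_mem c ha) hf }
  res i f h := S.toPrelocal.sheafify.res i f h

theorem mem_sheafify_of_mem (S : SubPresheaf k M) {U : Opens X} {f : ∀ x : U, M x.1}
    (h : f ∈ S.sec U) : f ∈ S.sheafify.sec U :=
  PrelocalPredicate.sheafifyOf (P := S.toPrelocal) h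

/-- The presheaf of finite `k`-linear combinations of the given families. -/
def ofSpan (G : ∀ U : Opens X, Set (∀ x : U, M x.1))
    (hG : ∀ {U V : Opens X} (i : U ⟶ V) (f : ∀ x : V, M x.1), f ∈ G V →
      (fun x : U => f (i x)) ∈ G U) : SubPresheaf k M where
  sec U := Submodule.span k (G U)
  res {U V} i f h := by
    let r : (∀ x : V, M x.1) →ₗ[k] (∀ x : U, M x.1) :=
      LinearMap.pi fun x => LinearMap.proj (i x)
    have h2 : r f ∈ (Submodule.span k (G V)).map r := Submodule.mem_map_of_mem h
    rw [Submodule.map_span] at h2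
    refine Submodule.span_mono ?_ h2
    rintro _ ⟨g, hg, rfl⟩
    exact hG i g hg

end SubPresheaf

end SubPresheaf
/-! ### Geigle–Lenzing orders on projective space -/

section Sheaves

variable {k : Type u} [Field k] {d n : ℕ}

variable (k d) in
/-- The polynomial ring `S = k[T_0, …, T_d]` graded by degree. -/
abbrev polyGrading : ℕ → Submodule k (MvPolynomial (Fin (d + 1)) k) :=
  MvPolynomial.homogeneousSubmodule (Fin (d + 1)) k

instance : GradedAlgebra (polyGrading k d) := MvPolynomial.gradedAlgebra

variable (k d) in
/-- The topological space of the scheme `ℙ^d = Proj k[T_0, …, T_d]`. -/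
abbrev projSpace : TopCat.{u} := ProjectiveSpectrum.top (polyGrading k d)

/-- The homogeneous prime ideal of `S` corresponding to the point `x`. -/
abbrev primeAt (x : projSpace k d) : Ideal (MvPolynomial (Fin (d + 1)) k) :=
  HomogeneousIdeal.toIdeal (ProjectiveSpectrum.asHomogeneousIdeal x)

instance (x : projSpace k d) : (primeAt x).IsPrime := ProjectiveSpectrum.isPrime x

/-- The stalk of the structure sheaf `𝒪` of `ℙ^d` at `x`: the degree `0` part of the localization of
`S` at the homogeneous elements outside the prime `x`. -/
def OStalk (x : projSpace k d) : Type u :=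
  HomogeneousLocalization.AtPrime (polyGrading k d) (primeAt x)

instance (x : projSpace k d) : CommRing (OStalk x) :=
  inferInstanceAs (CommRing (HomogeneousLocalization.AtPrime (polyGrading k d) (primeAt x)))

instance (x : projSpace k d) : Algebra k (OStalk x) :=
  ((HomogeneousLocalization.fromZeroRingHom (polyGrading k d) (primeAt x).primeCompl).comp
    (algebraMap k (polyGrading k d 0))).toAlgebra

/-- The localization `S_x` of the polynomial ring at the prime `x`, containing the stalks of all the
twists of `𝒪`. -/
abbrev polyLoc (x : projSpace k d) : Type u := Localization.AtPrime (primeAt x)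

instance (x : projSpace k d) : Algebra (OStalk x) (polyLoc x) :=
  inferInstanceAs (Algebra (HomogeneousLocalization.AtPrime (polyGrading k d) (primeAt x))
    (Localization.AtPrime (primeAt x)))

/-- The sections of the structure sheaf of `ℙ^d = Proj S` over `U`. -/
def regular (U : Opens (projSpace k d)) : Subring (∀ x : U, OStalk x.1) :=
  ProjectiveSpectrum.StructureSheaf.sectionsSubring (𝒜 := polyGrading k d) (.op U)

theorem regular_res {U V : Opens (projSpace k d)} (i : U ⟶ V) {f : ∀ x : V, OStalk x.1}
    (hf : f ∈ regular V) : (fun x : U => f (i x)) ∈ regular U :=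
  (ProjectiveSpectrum.StructureSheaf.isLocallyFraction (polyGrading k d)).res i f hf

/-- The stalk of `𝒪(1)` at `x`: the fractions `a / b` in `S_x` with `a`, `b` homogeneous,
`deg a = deg b + 1` and `b ∉ x`. -/
def O1Stalk (x : projSpace k d) : Submodule (OStalk x) (polyLoc x) where
  carrier := {z | ∃ (e : ℕ) (a : polyGrading k d (e + 1)) (b : polyGrading k d e)
    (hb : b.1 ∈ (primeAt x).primeCompl), z = Localization.mk a.1 ⟨b.1, hb⟩}
  zero_mem' := ⟨0, 0, ⟨1, SetLike.GradedOne.one_mem⟩, one_mem _, (Localization.mk_zero _).symm⟩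
  add_mem' := by
    rintro _ _ ⟨e, a, b, hb, rfl⟩ ⟨e', a', b', hb', rfl⟩
    refine ⟨e + e', ⟨b.1 * a'.1 + b'.1 * a.1, add_mem ?_ ?_⟩, ⟨b.1 * b'.1, SetLike.mul_mem_graded b.2 b'.2⟩,
      mul_mem hb hb', ?_⟩
    · simpa only [add_assoc] using SetLike.mul_mem_graded b.2 a'.2
    · have := SetLike.mul_mem_graded b'.2 a.2
      rwa [← add_assoc, add_comm e' e] at this
    · rw [Localization.add_mk]; rfl
  smul_mem' := by
    rintro c _ ⟨e, a, b, hb, rfl⟩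
    obtain ⟨c, rfl⟩ := HomogeneousLocalization.mk_surjective c
    refine ⟨c.deg + e, ⟨c.num.1 * a.1, ?_⟩, ⟨c.den.1 * b.1, SetLike.mul_mem_graded c.den.2 b.2⟩,
      mul_mem c.den_mem hb, ?_⟩
    · simpa only [add_assoc] using SetLike.mul_mem_graded c.num.2 a.2
    · exact Localization.mk_mul _ _ _ _

/-- Families of germs of `𝒪(1)` given by one fraction `a / b`. -/
def twistPre : PrelocalPredicate fun x : projSpace k d => O1Stalk x where
  pred {U} f := ∃ (e : ℕ) (a : polyGrading k d (e + 1)) (b : polyGrading k d e)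
    (hb : ∀ x : U, b.1 ∈ (primeAt x.1).primeCompl),
    ∀ x : U, (f x : polyLoc x.1) = Localization.mk a.1 ⟨b.1, hb x⟩
  res := by
    rintro U V i f ⟨e, a, b, hb, h⟩
    exact ⟨e, a, b, fun x => hb (i x), fun x => h (i x)⟩

/-- The sheaf `𝒪(1)`: families of germs locally given by fractions. -/
def twist : LocalPredicate fun x : projSpace k d => O1Stalk x := twistPre.sheafify

/-- The linear form `ℓ_i = ∑ j, λ_{i,j} T_j` with coefficients `coef i j = λ_{i,j}`; the hyperplane
`L_i` is its zero locus. -/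
def linearForm (coef : Fin n → Fin (d + 1) → k) (i : Fin n) : MvPolynomial (Fin (d + 1)) k :=
  ∑ j, MvPolynomial.C (coef i j) * MvPolynomial.X j

variable (coef : Fin n → Fin (d + 1) → k) (p : Fin n → ℕ)

/-- The stalk at `x` of the ideal sheaf `𝒪(-L_i)` of the hyperplane `ℓ_i = 0`: the germs of
functions that are divisible by `ℓ_i` in `S_x`. -/
def idealStalk (i : Fin n) (x : projSpace k d) : Ideal (OStalk x) :=
  (Ideal.span {algebraMap _ (polyLoc x) (linearForm coef i)}).comap (algebraMap (OStalk x) (polyLoc x))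

/-- The stalk at `x` of `Λ_i = T_{p_i}(𝒪, 𝒪(-L_i))`. -/
abbrev FactorStalk (i : Fin n) (x : projSpace k d) :
    Subalgebra (OStalk x) (Matrix (Fin (p i)) (Fin (p i)) (OStalk x)) :=
  triangular (OStalk x) (idealStalk coef i x) (p i)

/-- The stalk at `x` of `Λ = Λ_1 ⊗_𝒪 ⋯ ⊗_𝒪 Λ_n`. -/
def OrderStalk (x : projSpace k d) : Type u := ⨂[OStalk x] i : Fin n, FactorStalk coef p i x

instance (x : projSpace k d) : Ring (OrderStalk coef p x) :=
  inferInstanceAs (Ring (⨂[OStalk x] i : Fin n, FactorStalk coef p i x))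

instance (x : projSpace k d) : Algebra (OStalk x) (OrderStalk coef p x) :=
  inferInstanceAs (Algebra (OStalk x) (⨂[OStalk x] i : Fin n, FactorStalk coef p i x))

instance (x : projSpace k d) : Algebra k (OrderStalk coef p x) :=
  Algebra.compHom _ (algebraMap k (OStalk x))

/-- The stalk at `x` of `L = Λ ⊗_𝒪 𝒪(1)`, a `Λ_x`-bimodule via the two multiplications on the first
factor (the instances below). -/
def LStalk (x : projSpace k d) : Type u := OrderStalk coef p x ⊗[OStalk x] O1Stalk x

instance (x : projSpace k d) : AddCommGroup (LStalk coef p x) :=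
  inferInstanceAs (AddCommGroup (OrderStalk coef p x ⊗[OStalk x] O1Stalk x))

instance (x : projSpace k d) : Module (OStalk x) (LStalk coef p x) :=
  inferInstanceAs (Module (OStalk x) (OrderStalk coef p x ⊗[OStalk x] O1Stalk x))

instance (x : projSpace k d) : Module k (LStalk coef p x) :=
  Module.compHom _ (algebraMap k (OStalk x))

instance (x : projSpace k d) : Module (OrderStalk coef p x) (LStalk coef p x) :=
  inferInstanceAs (Module (OrderStalk coef p x) (OrderStalk coef p x ⊗[OStalk x] O1Stalk x))

instance (x : projSpace k d) : Module (OrderStalk coef p x)ᵐᵒᵖ (LStalk coef p x) :=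
  inferInstanceAs (Module (OrderStalk coef p x)ᵐᵒᵖ (OrderStalk coef p x ⊗[OStalk x] O1Stalk x))

instance (x : projSpace k d) :
    SMulCommClass (OrderStalk coef p x)ᵐᵒᵖ (OStalk x) (LStalk coef p x) :=
  inferInstanceAs (SMulCommClass (OrderStalk coef p x)ᵐᵒᵖ (OStalk x)
    (OrderStalk coef p x ⊗[OStalk x] O1Stalk x))

/-- The stalk at `x` of the tensor ring of `L` over `Λ`. -/
abbrev TStalk (x : projSpace k d) : Type u := TensorRing k (OrderStalk coef p x) (LStalk coef p x)

/-- The presheaf of finite sums of pure tensors `s_1 ⊗ ⋯ ⊗ s_n`, where `s_i` is a section of `Λ_i`,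
i.e. a family of germs of `Λ_i` all of whose matrix entries are sections of `𝒪`. -/
def orderPre : SubPresheaf k (OrderStalk coef p) :=
  SubPresheaf.ofSpan
    (fun U => {s | ∃ f : ∀ (i : Fin n) (x : U), FactorStalk coef p i x.1,
      (∀ i a b, (fun x : U => (f i x).1 a b) ∈ regular U) ∧
      s = fun x : U => PiTensorProduct.tprod (OStalk x.1) fun i => f i x})
    (by
      rintro U V j _ ⟨f, hf, rfl⟩
      exact ⟨fun i x => f i (j x), fun i a b => regular_res j (hf i a b), rfl⟩)

/-- The Geigle–Lenzing order `Λ`, a sheaf of rings on `ℙ^d`. -/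
def order : SubPresheaf k (OrderStalk coef p) := (orderPre coef p).sheafify

/-- The presheaf of finite sums of tensors `s ⊗ t` of sections of `Λ` and of `𝒪(1)`. -/
def LPre : SubPresheaf k (LStalk coef p) :=
  SubPresheaf.ofSpan
    (fun U => {s | ∃ (f : ∀ x : U, OrderStalk coef p x.1) (g : ∀ x : U, O1Stalk x.1),
      f ∈ (order coef p).sec U ∧ twist.pred g ∧ s = fun x : U => f x ⊗ₜ[OStalk x.1] g x})
    (by
      rintro U V j _ ⟨f, g, hf, hg, rfl⟩
      exact ⟨fun x => f (j x), fun x => g (j x), (order coef p).res j f hf, twist.res j g hg, rfl⟩)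

/-- The sheaf `L = Λ ⊗_𝒪 𝒪(1)`. -/
def L : SubPresheaf k (LStalk coef p) := (LPre coef p).sheafify

/-- The sections of `Λ` over `U`, in degree `0` of the tensor ring. -/
def orderPart (U : Opens (projSpace k d)) : Submodule k (∀ x : U, TStalk coef p x.1) :=
  ((order coef p).sec U).map (LinearMap.pi fun x =>
    (TensorRing.ofRing k (OrderStalk coef p x.1) (LStalk coef p x.1)).toLinearMap ∘ₗ
      LinearMap.proj x)

/-- The sections of `L` over `U`, in degree `1` of the tensor ring. -/
def LPart (U : Opens (projSpace k d)) : Submodule k (∀ x : U, TStalk coef p x.1) :=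
  ((L coef p).sec U).map (LinearMap.pi fun x =>
    TensorRing.ofModule k (OrderStalk coef p x.1) (LStalk coef p x.1) ∘ₗ LinearMap.proj x)

/-- The presheaf of finite sums of tensors `a m_1 ⊗ ⋯ ⊗ m_l` of a section `a` of `Λ` and sections
`m_i` of `L`. -/
def powPre (l : ℕ) : SubPresheaf k (TStalk coef p) where
  sec U := orderPart coef p U * LPart coef p U ^ l
  res {U V} i f h := by
    let r : (∀ x : V, TStalk coef p x.1) →ₐ[k] (∀ x : U, TStalk coef p x.1) :=
      AlgHom.pi fun x => Pi.evalAlgHom k (fun x : V => TStalk coef p x.1) (i x)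
    have h2 : r f ∈ (orderPart coef p V * LPart coef p V ^ l).map r.toLinearMap :=
      Submodule.mem_map_of_mem h
    rw [Submodule.map_mul, Submodule.map_pow] at h2
    have hA : (orderPart coef p V).map r.toLinearMap ≤ orderPart coef p U := by
      rintro _ ⟨_, ⟨g, hg, rfl⟩, rfl⟩
      exact ⟨_, (order coef p).res i g hg, rfl⟩
    have hL : (LPart coef p V).map r.toLinearMap ≤ LPart coef p U := by
      rintro _ ⟨_, ⟨g, hg, rfl⟩, rfl⟩
      exact ⟨_, (L coef p).res i g hg, rfl⟩
    exact mul_le_mul' hA (pow_le_pow_left' hL l) h2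

/-- The sheaf `L^{⊗_Λ l}`. -/
def tensorPow (l : ℕ) : SubPresheaf k (TStalk coef p) := (powPre coef p l).sheafify

/-- The global sections `H^0(ℙ^d, L^{⊗_Λ l})`. -/
def H0 (l : ℕ) : Submodule k (∀ x : (⊤ : Opens (projSpace k d)), TStalk coef p x.1) :=
  (tensorPow coef p l).sec ⊤

/-! Products of global sections of `L^{⊗ a}` and `L^{⊗ b}` are global sections of `L^{⊗ (a + b)}`. -/

theorem order_one (U : Opens (projSpace k d)) : (1 : ∀ x : U, OrderStalk coef p x.1) ∈ (order coef p).sec U := by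
  refine SubPresheaf.mem_sheafify_of_mem _ (Submodule.subset_span ⟨fun i x => 1, fun i a b => ?_, rfl⟩)
  by_cases h : a = b
  · subst h
    have e : (fun x : U => (1 : FactorStalk coef p i x.1).1 a a) = 1 :=
      funext fun x => Matrix.one_apply_eq a
    exact e ▸ (regular U).one_mem
  · have e : (fun x : U => (1 : FactorStalk coef p i x.1).1 a b) = 0 :=
      funext fun x => Matrix.one_apply_ne h
    exact e ▸ (regular U).zero_mem

theorem order_mul {U : Opens (projSpace k d)} {f g : ∀ x : U, OrderStalk coef p x.1}
    (hf : f ∈ (order coef p).sec U) (hg : g ∈ (order coef p).sec U) :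
    f * g ∈ (order coef p).sec U := by
  have key : ∀ {U : Opens (projSpace k d)} {f g : ∀ x : U, OrderStalk coef p x.1},
      f ∈ (orderPre coef p).sec U → g ∈ (orderPre coef p).sec U →
      f * g ∈ (orderPre coef p).sec U := by
    intro U f g hf hg
    have := Submodule.mul_mem_mul hf hg
    refine (Submodule.span_mul_span k _ _).trans_le (Submodule.span_mono ?_) this
    rintro _ ⟨_, ⟨f, hf, rfl⟩, _, ⟨g, hg, rfl⟩, rfl⟩
    refine ⟨fun i x => f i x * g i x, fun i a b => ?_, ?_⟩
    · have e : (fun x : U => (f i x * g i x).1 a b) =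
          ∑ c, (fun x : U => (f i x).1 a c) * (fun x : U => (g i x).1 c b) := by
        funext x
        rw [Finset.sum_apply]
        rfl
      exact e ▸ (regular U).sum_mem fun c _ => (regular U).mul_mem (hf i a c) (hg i c b)
    · funext x
      exact PiTensorProduct.tprod_mul_tprod _ _
  exact PrelocalPredicate.sheafify_inductionOn₂' (orderPre coef p).toPrelocal
    (orderPre coef p).toPrelocal (orderPre coef p).toPrelocal (· * ·)
    (fun {U V a b} ha hb => key ((orderPre coef p).res (Opens.infLELeft U V) a ha)
      ((orderPre coef p).res (Opens.infLERight U V) b hb)) hf hg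

theorem L_mul_order {U : Opens (projSpace k d)} {m : ∀ x : U, LStalk coef p x.1}
    {g : ∀ x : U, OrderStalk coef p x.1}
    (hm : m ∈ (L coef p).sec U) (hg : g ∈ (order coef p).sec U) :
    (fun x => MulOpposite.op (g x) • m x) ∈ (L coef p).sec U := by
  intro x
  obtain ⟨V, hx, i, hV⟩ := hm x
  refine ⟨V, hx, i, ?_⟩
  have hg' : (fun y : V => g (i y)) ∈ (order coef p).sec V := (order coef p).res i g hg
  let r : (∀ y : V, LStalk coef p y.1) →ₗ[k] (∀ y : V, LStalk coef p y.1) :=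
    { toFun := fun w y => MulOpposite.op (g (i y)) • w y
      map_add' := fun w w' => funext fun y => smul_add _ _ _
      map_smul' := fun c w => funext fun y => smul_comm (MulOpposite.op (g (i y)) : (OrderStalk coef p y.1)ᵐᵒᵖ)
        (algebraMap k (OStalk y.1) c) (w y) }
  have h2 : r (fun y : V => m (i y)) ∈ ((LPre coef p).sec V).map r := Submodule.mem_map_of_mem hV
  refine Submodule.map_le_iff_le_comap.2 (Submodule.span_le.2 ?_) h2
  rintro _ ⟨f, t, hf, ht, rfl⟩
  exact Submodule.subset_span ⟨f * fun y => g (i y), t, order_mul coef p hf hg', ht, rfl⟩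

theorem powPre_mul {U : Opens (projSpace k d)} (a b : ℕ) :
    (powPre coef p a).sec U * (powPre coef p b).sec U ≤ (powPre coef p (a + b)).sec U := by
  set A := orderPart coef p U
  set M := LPart coef p U
  have h1 : (1 : Submodule k (∀ x : U, TStalk coef p x.1)) ≤ A := by
    rw [Submodule.one_le]
    refine ⟨_, order_one coef p U, ?_⟩
    funext x
    exact map_one (TensorRing.ofRing k (OrderStalk coef p x.1) (LStalk coef p x.1))
  have hAA : A * A ≤ A := by
    rw [Submodule.mul_le]
    rintro _ ⟨f, hf, rfl⟩ _ ⟨g, hg, rfl⟩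
    refine ⟨_, order_mul coef p hf hg, ?_⟩
    funext x
    exact map_mul (TensorRing.ofRing k (OrderStalk coef p x.1) (LStalk coef p x.1)) _ _
  have hMA : M * A ≤ M := by
    rw [Submodule.mul_le]
    rintro _ ⟨m, hm, rfl⟩ _ ⟨g, hg, rfl⟩
    refine ⟨_, L_mul_order coef p hm hg, ?_⟩
    funext x
    exact TensorRing.ofModule_op_smul k (m x) (g x)
  have hpow : ∀ a : ℕ, M ^ a * A ≤ A * M ^ a := by
    intro a
    cases a with
    | zero => simp
    | succ a =>
      calc M ^ (a + 1) * A = M ^ a * (M * A) := by rw [pow_succ, mul_assoc]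
        _ ≤ M ^ a * M := mul_le_mul_right hMA _
        _ = 1 * M ^ (a + 1) := by rw [one_mul, pow_succ]
        _ ≤ A * M ^ (a + 1) := mul_le_mul_left h1 _
  calc A * M ^ a * (A * M ^ b) = A * (M ^ a * A) * M ^ b := by simp only [mul_assoc]
    _ ≤ A * (A * M ^ a) * M ^ b := mul_le_mul_left (mul_le_mul_right (hpow a) _) _
    _ = A * A * M ^ (a + b) := by simp only [mul_assoc, pow_add]
    _ ≤ A * M ^ (a + b) := mul_le_mul_left hAA _

instance : SetLike.GradedMonoid (H0 coef p) where
  one_mem := by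
    refine SubPresheaf.mem_sheafify_of_mem _ ?_
    change 1 ∈ orderPart coef p ⊤ * LPart coef p ⊤ ^ 0
    rw [pow_zero, mul_one]
    refine ⟨_, order_one coef p ⊤, ?_⟩
    funext x
    exact map_one (TensorRing.ofRing k (OrderStalk coef p x.1) (LStalk coef p x.1))
  mul_mem a b f g hf hg :=
    PrelocalPredicate.sheafify_inductionOn₂' (powPre coef p a).toPrelocal
      (powPre coef p b).toPrelocal (powPre coef p (a + b)).toPrelocal (· * ·)
      (fun {U V f g} hf hg => powPre_mul coef p a b (Submodule.mul_mem_mul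
        ((powPre coef p a).res (Opens.infLELeft U V) f hf)
        ((powPre coef p b).res (Opens.infLERight U V) g hg))) hf hg

/-- The graded `k`-algebra `B(Λ, L) = ⨁_{l ≥ 0} H^0(ℙ^d, L^{⊗_Λ l})`, with multiplication given by
the tensor product of sections. -/
abbrev B : Type u := ⨁ l : ℕ, H0 coef p l

/-- The degree `m` part of `B(Λ, L)` for an integer `m` (zero if `m < 0`). -/
def degB (m : ℤ) : Submodule k (B coef p) :=
  ⨆ (l : ℕ) (_ : (l : ℤ) = m), LinearMap.range (DirectSum.lof k ℕ (fun l => H0 coef p l) l)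
end Sheaves

/-! ### The ring `A^{[H]}` -/

section Regrade

variable {k : Type*} [Field k] {G A : Type*} [AddCommGroup G] [Ring A] [Algebra k A]
  (𝒜 : G → Submodule k A) (H : AddSubgroup G) {I : Type*} (rep : I → G)

/-- The degree `h` part `(A_{i - j + h})_{i,j}` of `A^{[H]}`, as a space of matrices over `A`, for a
`G`-graded algebra `A`, a subgroup `H` and representatives `rep : I → G` of the cosets of `H`. -/
def regradePiece (h : H) : Submodule k (Matrix I I A) where
  carrier := {M | ∀ i j, M i j ∈ 𝒜 (rep i - rep j + h)}
  zero_mem' _ _ := zero_mem _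
  add_mem' hM hN i j := add_mem (hM i j) (hN i j)
  smul_mem' c _ hM i j := Submodule.smul_mem _ c (hM i j)

instance [Fintype I] [DecidableEq I] [SetLike.GradedMonoid 𝒜] :
    SetLike.GradedMonoid (regradePiece 𝒜 H rep) where
  one_mem i j := by
    by_cases h : i = j
    · subst h
      simpa using SetLike.GradedOne.one_mem (A := 𝒜)
    · rw [Matrix.one_apply_ne h]
      exact zero_mem _
  mul_mem g h M N hM hN i j := by
    rw [Matrix.mul_apply]
    refine sum_mem fun c _ => ?_
    have e : rep i - rep j + ((g + h : H) : G) = (rep i - rep c + g) + (rep c - rep j + h) := by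
      rw [AddSubgroup.coe_add]; abel
    rw [e]
    exact SetLike.mul_mem_graded (hM i c) (hN c j)

/-- The `H`-graded ring `A^{[H]} = ⨁_{h ∈ H} (A_{i - j + h})_{i,j}`, with multiplication induced by
the multiplication of matrices over `A`. -/
abbrev Regrade : Type _ := ⨁ h : H, regradePiece 𝒜 H rep h

/-- The degree `h` part of `A^{[H]}`, as a subspace. -/
def degRegrade [DecidableEq G] (h : H) : Submodule k (Regrade 𝒜 H rep) :=
  LinearMap.range (DirectSum.lof k H (fun h => regradePiece 𝒜 H rep h) h)

end Regrade

/-! ### The ring `R` of a Geigle–Lenzing projective space -/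

section GLRing

variable {n : ℕ} (p : Fin n → ℕ)

/-- The abelian group `𝕃(p)` generated by `x_1, …, x_n, c` with relations `p_i x_i = c`. -/
abbrev WeightGroup : Type :=
  ((Fin n → ℤ) × ℤ) ⧸ AddSubgroup.closure
    (Set.range fun i : Fin n => ((Pi.single i (p i : ℤ), -1) : (Fin n → ℤ) × ℤ))

instance : DecidableEq (WeightGroup p) := Classical.decEq _

/-- The generator `x_i` of `𝕃(p)`. -/
def xvec (i : Fin n) : WeightGroup p := QuotientAddGroup.mk (Pi.single i 1, 0)

/-- The generator `c` of `𝕃(p)`. -/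
def cvec : WeightGroup p := QuotientAddGroup.mk (0, 1)

variable {k : Type u} [Field k] {d : ℕ} (coef : Fin n → Fin (d + 1) → k)

/-- The ideal of `k[T_0, …, T_d, X_1, …, X_n]` generated by the `X_i ^ p_i - ℓ_i(T)`. -/
def relIdeal : Ideal (MvPolynomial (Fin (d + 1) ⊕ Fin n) k) :=
  Ideal.span (Set.range fun i : Fin n => MvPolynomial.X (Sum.inr i) ^ p i -
    MvPolynomial.rename Sum.inl (linearForm coef i))

/-- The ring `R = k[T, X] / (X_i ^ p_i - ℓ_i(T))`. -/
abbrev GLRing : Type u := MvPolynomial (Fin (d + 1) ⊕ Fin n) k ⧸ relIdeal p coef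

/-- The degrees of the variables: `deg T_j = c` and `deg X_i = x_i`. -/
def weight : Fin (d + 1) ⊕ Fin n → WeightGroup p :=
  Sum.elim (fun _ => cvec p) (xvec p)

/-- The `𝕃(p)`-grading of `R`. -/
def glGrading (g : WeightGroup p) : Submodule k (GLRing p coef) :=
  (MvPolynomial.weightedHomogeneousSubmodule k (weight p) g).map
    (Ideal.Quotient.mkₐ k (relIdeal p coef)).toLinearMap

instance : SetLike.GradedMonoid (glGrading p coef) where
  one_mem := ⟨1, MvPolynomial.isWeightedHomogeneous_one k _, map_one (Ideal.Quotient.mkₐ k (relIdeal p coef))⟩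
  mul_mem := by
    rintro g h _ _ ⟨a, ha, rfl⟩ ⟨b, hb, rfl⟩
    exact ⟨a * b, MvPolynomial.IsWeightedHomogeneous.mul ha hb, map_mul (Ideal.Quotient.mkₐ k (relIdeal p coef)) a b⟩

/-- The representatives `∑ a_i x_i`, `0 ≤ a_i < p_i`, of the cosets of `ℤc` in `𝕃(p)`. -/
def stdRep (a : ∀ i : Fin n, Fin (p i)) : WeightGroup p := ∑ i, (a i : ℕ) • xvec p i

/-- The ring `R^{[ℤc]}`, formed with the representatives `∑ a_i x_i`, `0 ≤ a_i < p_i`. -/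
abbrev GLRegrade : Type u :=
  Regrade (glGrading p coef) (AddSubgroup.zmultiples (cvec p)) (stdRep p)

/-- The degree `m` part of `R^{[ℤc]}`, where `m` is identified with `mc`. -/
def degGLRegrade (m : ℤ) : Submodule k (GLRegrade p coef) :=
  degRegrade (glGrading p coef) (AddSubgroup.zmultiples (cvec p)) (stdRep p)
    ⟨m • cvec p, AddSubgroup.zsmul_mem_zmultiples _ _⟩

/-- The hyperplanes `ℓ_i = 0` are in general position: any `m` of them meet in codimension `m` in
`ℙ^d`, or not at all if `m > d`. In terms of linear algebra, the common kernel in `k^{d+1}` of any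
`m` of the linear forms has dimension `d + 1 - m`, or `0` if `m > d` (truncated subtraction). -/
def GeneralPosition : Prop :=
  ∀ s : Finset (Fin n), Module.finrank k
    (LinearMap.ker (Matrix.of fun (i : s) (j : Fin (d + 1)) => coef i j).mulVecLin) = d + 1 - s.card

end GLRing
end GLOrder

end

/-!
Let `S = k[T_0, …, T_d]` and let `Ω` be a field containing `S` and `p_i`-th roots `y_i` of the linear
forms `ℓ_i`; an algebraic closure of the fraction field of `S` will do. The graded pieces of both rings
are embedded, compatibly with products, in the matrices over `Ω` with rows and columns indexed by
`∏ Fin (p i)`, and in degree `l` both images are the same space `formMatrices`: the matrices whose entry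
`(a, b)` is a form of degree `l` divisible by the product `prodGen` of all `ℓ_i` with `a i < b i`.

*The side of `B(Λ, L)`.* At a point `x` where `T_j ≠ 0`, the ideal of `L_i` is generated by the nonzero
germ `ℓ_i / T_j` (`idealStalk_eq_span`), so each `Λ_i` is free on multiples of the matrix units and the
Kronecker product embeds the stalk of `Λ` in a matrix ring (`kronecker_injective`), with entry `(a, b)`
divisible by the product of the `ℓ_i / T_j` with `a i < b i`. The stalk of `L` is generated by `T_j`,
which commutes with `Λ`, so a germ of `L^{⊗ l}` is `c T_j ^ l` with `c` in `Λ`; mapping it to `T_j ^ l`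
times the matrix of `c` embeds it in the matrices over `Ω` (`eq_zero_of_fieldMatrix_eq_zero`). The
matrix of a section is locally constant, hence constant, because all nonempty open sets contain the
generic point (`eq_of_locally_eq`). Each entry of the matrix of a global section is the product
`prodGen` times an element of `Ω` that is at every point a fraction with homogeneous denominator. Such
an element is a polynomial when `d ≥ 1` (`exists_eq_algebraMap`), and by its degree it is a form.
Conversely, products of matrix units and of forms give sections with any matrix in `formMatrices` where
`T_j ≠ 0`, and these glue, since germs are determined by their matrices (`range_sectionMatrix`).

*The side of `R^{[ℤc]}`.* Modulo the relations `X_i ^ p_i = ℓ_i`, every element of `R` of degree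
`x_a - x_b + l c` is `∏ X_i ^ e_i` times a polynomial `F`, where `e_i` in `[0, p_i)` is congruent to
`a i - b i` and `prodGen * F` is a form of degree `l` (`exists_glGrading_eq`). Send `X_i` to `y_i` and
conjugate by the diagonal matrix with entries `∏ y_i ^ (a i)`: since `e_i` is `a i - b i`, plus `p_i` if
`a i < b i`, the entry becomes exactly `prodGen * F` (`conjMatrix_entry`), and the image of the piece of
degree `l` is `formMatrices` (`range_conjMatrix`). The pieces of negative degree vanish.
-/

noncomputable section

universe u

namespace GLOrder

/-! ### Fractions with homogeneous denominators -/

section Polynomials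

variable {k : Type u} [Field k] {d n : ℕ}

/-- Membership in a homogeneous prime can be tested on homogeneous components. -/
theorem exists_decompose_notMem (x : projSpace k d) {v : MvPolynomial (Fin (d + 1)) k}
    (hv : v ∉ primeAt x) :
    ∃ r, (DirectSum.decompose (polyGrading k d) v r : MvPolynomial (Fin (d + 1)) k) ∉
      primeAt x := by
  by_contra! h
  classical
  refine hv ?_
  rw [← DirectSum.sum_support_decompose (polyGrading k d) v]
  exact sum_mem fun r _ => h r

/-- The coordinates have no common zero on projective space. -/
theorem exists_X_notMem (x : projSpace k d) :
    ∃ j, (MvPolynomial.X j : MvPolynomial (Fin (d + 1)) k) ∉ primeAt x := by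
  by_contra! h
  refine x.not_irrelevant_le fun a ha => ?_
  have hle : Ideal.span (MvPolynomial.X '' (Set.univ : Set (Fin (d + 1)))) ≤ primeAt x := by
    rw [Ideal.span_le]
    rintro _ ⟨j, -, rfl⟩
    exact h j
  refine hle (MvPolynomial.mem_ideal_span_X_image.2 fun m hm => ?_)
  by_contra! hm0
  have : m = 0 := Finsupp.ext fun j => hm0 j (Set.mem_univ j)
  subst this
  refine MvPolynomial.mem_support_iff.1 hm ?_
  have h0 := (HomogeneousIdeal.mem_irrelevant_iff _ _).1 ha
  have h1 : MvPolynomial.homogeneousComponent 0 a = 0 := by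
    rw [← MvPolynomial.decomposition.decompose'_apply a 0]
    exact h0
  rw [MvPolynomial.homogeneousComponent_zero] at h1
  exact MvPolynomial.C_eq_zero.1 h1

variable (k d) in
/-- The generic point of `ℙ^d`, i.e. the zero ideal. -/
def genericPoint : projSpace k d where
  asHomogeneousIdeal := ⊥
  isPrime := by
    rw [HomogeneousIdeal.toIdeal_bot]
    exact Ideal.isPrime_bot
  not_irrelevant_le h := by
    have hX : (MvPolynomial.X 0 : MvPolynomial (Fin (d + 1)) k) ∈
        HomogeneousIdeal.irrelevant (polyGrading k d) := by
      rw [HomogeneousIdeal.mem_irrelevant_iff, GradedRing.proj_apply,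
        DirectSum.decompose_of_mem_ne (polyGrading k d) (MvPolynomial.isHomogeneous_X k 0)
          one_ne_zero]
    have h0 := HomogeneousIdeal.mem_iff.2 (h hX)
    rw [HomogeneousIdeal.toIdeal_bot] at h0
    exact MvPolynomial.X_ne_zero (R := k) (0 : Fin (d + 1)) h0

theorem genericPoint_mem {U : Opens (projSpace k d)} (x : projSpace k d) (hx : x ∈ U) :
    genericPoint k d ∈ U := by
  obtain ⟨_, ⟨f, rfl⟩, hf, hfU⟩ :=
    (ProjectiveSpectrum.isTopologicalBasis_basic_opens (polyGrading k d)).exists_subset_of_mem_open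
      hx U.isOpen
  refine hfU fun h0 => hf ?_
  have : f = 0 := by
    have h0' : f ∈ (⊥ : HomogeneousIdeal (polyGrading k d)).toIdeal := h0
    rwa [HomogeneousIdeal.toIdeal_bot] at h0'
  subst this
  exact zero_mem (primeAt x)

attribute [irreducible] genericPoint

/-- The quotient of a form of degree `e + l` by a form of degree `e` is a form of degree `l`. -/
theorem mem_of_mul_mem {e l : ℕ} {F v : MvPolynomial (Fin (d + 1)) k} (hv : v ∈ polyGrading k d e)
    (hv0 : v ≠ 0) (h : F * v ∈ polyGrading k d (e + l)) : F ∈ polyGrading k d l := by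
  have key : ∀ r, r ≠ l →
      (DirectSum.decompose (polyGrading k d) F r : MvPolynomial (Fin (d + 1)) k) = 0 := by
    intro r hr
    have h1 := DirectSum.coe_decompose_mul_add_of_right_mem (polyGrading k d) (i := r) (a := F) hv
    rw [DirectSum.decompose_of_mem_ne _ h (by omega)] at h1
    exact (mul_eq_zero.1 h1.symm).resolve_right hv0
  classical
  rw [← DirectSum.sum_support_decompose (polyGrading k d) F]
  refine sum_mem fun r _ => ?_
  by_cases hr : r = l
  · subst hr; exact SetLike.coe_mem _
  · rw [key r hr]; exact zero_mem _

/-- A polynomial whose product with a nonzero form is a form is itself a form, or zero; the second case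
is forced if the degree of the product is too small. -/
theorem eq_zero_or_exists_mem {e l : ℕ} {F G : MvPolynomial (Fin (d + 1)) k}
    (hG : G ∈ polyGrading k d e) (hG0 : G ≠ 0) (h : G * F ∈ polyGrading k d l) :
    F = 0 ∨ ∃ r, l = e + r ∧ F ∈ polyGrading k d r := by
  rw [mul_comm] at h
  by_cases hl : e ≤ l
  · obtain ⟨r, rfl⟩ := Nat.exists_eq_add_of_le hl
    exact Or.inr ⟨r, rfl, mem_of_mul_mem hG hG0 h⟩
  · refine Or.inl ((mul_eq_zero.1 ?_).resolve_right hG0)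
    rw [← DirectSum.decompose_of_mem_same (polyGrading k d) h]
    exact DirectSum.coe_decompose_mul_of_right_mem_of_not_le _ hG hl

variable {Ω : Type u} [Field Ω] [Algebra (MvPolynomial (Fin (d + 1)) k) Ω]

/-- A function that is everywhere a fraction with homogeneous denominator is a polynomial: a prime
factor `q` of its denominator in lowest terms would give a point of `ℙ^d`, the largest homogeneous
ideal contained in `(q)`, where this fails. In dimension at least one, this ideal is not
irrelevant. -/
theorem exists_eq_algebraMap (hinj : Function.Injective (algebraMap (MvPolynomial (Fin (d + 1)) k) Ω))
    (hd : 1 ≤ d) (z : Ω)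
    (hz : ∀ x : projSpace k d, ∃ u v : MvPolynomial (Fin (d + 1)) k,
      SetLike.IsHomogeneousElem (polyGrading k d) v ∧ v ∉ primeAt x ∧
        z * algebraMap _ Ω v = algebraMap _ Ω u) :
    ∃ F, z = algebraMap (MvPolynomial (Fin (d + 1)) k) Ω F := by
  obtain ⟨u₀, v₀, -, hv₀, hz₀⟩ := hz (genericPoint k d)
  have hv₀' : v₀ ≠ 0 := fun h => hv₀ (h ▸ zero_mem _)
  obtain ⟨v, u, c, hrel, rfl, rfl⟩ := UniqueFactorizationMonoid.exists_reduced_factors v₀ hv₀' u₀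
  have hc : c ≠ 0 := left_ne_zero_of_mul hv₀'
  have hv : v ≠ 0 := right_ne_zero_of_mul hv₀'
  have hcΩ : algebraMap (MvPolynomial (Fin (d + 1)) k) Ω c ≠ 0 :=
    (map_ne_zero_iff _ hinj).2 hc
  have hzv : z * algebraMap _ Ω v = algebraMap _ Ω u := by
    rw [map_mul, map_mul] at hz₀
    refine mul_left_cancel₀ hcΩ ?_
    linear_combination hz₀
  -- `v` is the denominator of `z` in lowest terms, so it divides every other denominator
  have hdvd : ∀ x : projSpace k d, ∃ w : MvPolynomial (Fin (d + 1)) k,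
      SetLike.IsHomogeneousElem (polyGrading k d) w ∧ w ∉ primeAt x ∧ v ∣ w := by
    intro x
    obtain ⟨u', w, hw, hwx, h⟩ := hz x
    refine ⟨w, hw, hwx, hrel.dvd_of_dvd_mul_left (y := u) ⟨u', hinj ?_⟩⟩
    rw [map_mul, map_mul]
    linear_combination algebraMap _ Ω v * h - algebraMap _ Ω w * hzv
  have hunit : IsUnit v := by
    by_contra hnu
    obtain ⟨q, hq, hqv⟩ := WfDvdMonoid.exists_irreducible_factor hnu hv
    have hqp : Prime q := UniqueFactorizationMonoid.irreducible_iff_prime.1 hq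
    have hQ : (Ideal.span {q}).IsPrime := (Ideal.span_singleton_prime hqp.ne_zero).2 hqp
    let x : projSpace k d :=
      { asHomogeneousIdeal := (Ideal.span {q}).homogeneousCore (polyGrading k d)
        isPrime := hQ.homogeneousCore
        not_irrelevant_le := by
          intro h
          have hX : ∀ j, q ∣ (MvPolynomial.X j : MvPolynomial (Fin (d + 1)) k) := by
            intro j
            rw [← Ideal.mem_span_singleton]
            refine Ideal.toIdeal_homogeneousCore_le (polyGrading k d) _ (h ?_)
            rw [HomogeneousIdeal.mem_irrelevant_iff, GradedRing.proj_apply,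
              DirectSum.decompose_of_mem_ne (polyGrading k d) (MvPolynomial.isHomogeneous_X k j)
                one_ne_zero]
          have h01 : (⟨0, by omega⟩ : Fin (d + 1)) ≠ ⟨1, by omega⟩ := by simp
          have h1 := hq.associated_of_dvd
            (MvPolynomial.X_prime (R := k) (i := (⟨0, by omega⟩ : Fin (d + 1)))).irreducible (hX _)
          exact h01 (MvPolynomial.X_dvd_X.1 (h1.symm.dvd.trans (hX ⟨1, by omega⟩))) }
    obtain ⟨w, hw, hwx, hvw⟩ := hdvd x
    exact hwx (Ideal.mem_homogeneousCore_of_homogeneous_of_mem hw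
      (Ideal.mem_span_singleton.2 (hqv.trans hvw)))
  obtain ⟨v', hv'⟩ := hunit.exists_right_inv
  refine ⟨u * v', ?_⟩
  rw [map_mul, ← hzv, mul_assoc, ← map_mul, hv', map_one, mul_one]

end Polynomials

/-! ### Tensor products of triangular matrix rings -/

section Triangular

variable {R : Type u} [CommRing R]

/-- The generator at the entry `(a, b)` of the ring `T_p(R, (γ))`: it is `γ` above the diagonal and
`1` elsewhere. -/
def entryGen {M : Type*} [One M] (γ : M) {p : ℕ} (a b : Fin p) : M := if a < b then γ else 1

theorem map_entryGen {M N F : Type*} [MulOneClass M] [MulOneClass N] [FunLike F M N]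
    [MonoidHomClass F M N] (f : F) (γ : M) {p : ℕ} (a b : Fin p) :
    f (entryGen γ a b) = entryGen (f γ) a b := by
  unfold entryGen
  split_ifs
  · rfl
  · exact map_one f

theorem entryGen_ne_zero {M : Type*} [MulZeroOneClass M] [Nontrivial M] {γ : M} (h : γ ≠ 0) {p : ℕ}
    (a b : Fin p) : entryGen γ a b ≠ 0 := by
  unfold entryGen
  split_ifs
  · exact h
  · exact one_ne_zero

/-- The matrices with entries `c (a, b) * entryGen γ a b` are in `T_p(R, I)` if `γ ∈ I`. -/
def triangularOfCoeff {I : Ideal R} {γ : R} (hγ : γ ∈ I) (p : ℕ) :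
    (Fin p × Fin p → R) →ₗ[R] triangular R I p where
  toFun c := ⟨Matrix.of fun a b => c (a, b) * entryGen γ a b, fun a b h => by
    rw [Matrix.of_apply, entryGen, if_pos h]
    exact I.mul_mem_left _ hγ⟩
  map_add' c c' := by
    ext a b
    exact add_mul _ _ _
  map_smul' r c := by
    ext a b
    exact mul_assoc _ _ _

variable [IsDomain R]

theorem triangularOfCoeff_bijective {I : Ideal R} {γ : R} (hI : I = Ideal.span {γ}) (hγ : γ ≠ 0)
    (hmem : γ ∈ I) (p : ℕ) : Function.Bijective (triangularOfCoeff hmem p) := by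
  refine ⟨fun c c' h => funext fun ab => mul_right_cancel₀ (entryGen_ne_zero hγ ab.1 ab.2)
      (congrFun (congrFun (congrArg Subtype.val h) ab.1) ab.2), fun M => ?_⟩
  have h : ∀ ab : Fin p × Fin p, ∃ c, c * entryGen γ ab.1 ab.2 = M.1 ab.1 ab.2 := by
    intro ab
    unfold entryGen
    split_ifs with hab
    · exact Ideal.mem_span_singleton'.1 (hI.le (M.2 _ _ hab))
    · exact ⟨_, mul_one _⟩
  choose c hc using h
  exact ⟨c, Subtype.ext (Matrix.ext fun a b => hc (a, b))⟩

/-- The basis of `T_p(R, (γ))` given by the matrix units, multiplied by `γ` above the diagonal. -/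
def triangularBasis {I : Ideal R} {γ : R} (hI : I = Ideal.span {γ}) (hγ : γ ≠ 0) (p : ℕ) :
    Module.Basis (Fin p × Fin p) R (triangular R I p) :=
  have hmem : γ ∈ I := hI ▸ Ideal.mem_span_singleton_self γ
  Module.Basis.ofEquivFun
    (LinearEquiv.ofBijective _ (triangularOfCoeff_bijective hI hγ hmem p)).symm

theorem triangularBasis_repr {I : Ideal R} {γ : R} (hI : I = Ideal.span {γ}) (hγ : γ ≠ 0) (p : ℕ)
    (M : triangular R I p) (a b : Fin p) :
    (triangularBasis hI hγ p).repr M (a, b) * entryGen γ a b = M.1 a b := by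
  have hmem : γ ∈ I := hI ▸ Ideal.mem_span_singleton_self γ
  have h := LinearEquiv.apply_symm_apply
    (LinearEquiv.ofBijective _ (triangularOfCoeff_bijective hI hγ hmem p)) M
  exact congrFun (congrFun (congrArg Subtype.val h) a) b

end Triangular

section TensorMatrix

variable {n : ℕ} {p : Fin n → ℕ}

/-- The product of the `γ i` over those `i` where `(a i, b i)` is above the diagonal. -/
def prodGen {M : Type*} [CommMonoid M] (γ : Fin n → M) (a b : ∀ i, Fin (p i)) : M :=
  ∏ i, entryGen (γ i) (a i) (b i)

/-- The number of indices `i` where `(a i, b i)` is above the diagonal. -/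
def numAbove (a b : ∀ i, Fin (p i)) : ℕ := ∑ i, if a i < b i then 1 else 0

theorem map_prodGen {M N F : Type*} [CommMonoid M] [CommMonoid N] [FunLike F M N]
    [MonoidHomClass F M N] (f : F) (γ : Fin n → M) (a b : ∀ i, Fin (p i)) :
    f (prodGen γ a b) = prodGen (fun i => f (γ i)) a b := by
  simp only [prodGen, map_prod, map_entryGen]

theorem prodGen_mul_const {M : Type*} [CommMonoid M] (γ : Fin n → M) (t : M)
    (a b : ∀ i, Fin (p i)) :
    prodGen (fun i => γ i * t) a b = prodGen γ a b * t ^ numAbove a b := by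
  rw [prodGen, prodGen, numAbove, ← Finset.prod_pow_eq_pow_sum, ← Finset.prod_mul_distrib]
  refine Finset.prod_congr rfl fun i _ => ?_
  unfold entryGen
  split_ifs <;> simp

theorem prodGen_ne_zero {M : Type*} [CommMonoidWithZero M] [NoZeroDivisors M] [Nontrivial M]
    {γ : Fin n → M} (h : ∀ i, γ i ≠ 0) (a b : ∀ i, Fin (p i)) : prodGen γ a b ≠ 0 :=
  Finset.prod_ne_zero_iff.2 fun i _ => entryGen_ne_zero (h i) _ _

variable {R : Type u} [CommRing R] {I : Fin n → Ideal R}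

/-- The map from the tensor product of the `T_{p_i}(R, I_i)` to matrices with rows and columns indexed
by `∏ Fin (p i)`, the Kronecker product of matrices. -/
def kronecker (I : Fin n → Ideal R) (p : Fin n → ℕ) :
    (⨂[R] i, triangular R (I i) (p i)) →ₐ[R] Matrix (∀ i, Fin (p i)) (∀ i, Fin (p i)) R :=
  PiTensorProduct.liftAlgHom
    ((Matrix.ofLinearEquiv R).toLinearMap.compMultilinearMap
      (MultilinearMap.pi fun a => MultilinearMap.pi fun b =>
        (MultilinearMap.mkPiAlgebra R (Fin n) R).compLinearMap fun i =>
          (Matrix.entryLinearMap R R (a i) (b i)).comp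
            (triangular R (I i) (p i)).val.toLinearMap))
    (by
      ext a b
      change ∏ i, (1 : Matrix (Fin (p i)) (Fin (p i)) R) (a i) (b i) =
        (1 : Matrix (∀ i, Fin (p i)) (∀ i, Fin (p i)) R) a b
      simp only [Matrix.one_apply]
      rw [Fintype.prod_ite_zero]
      simp [funext_iff])
    (by
      intro x y
      ext a b
      change ∏ i, ((x i).1 * (y i).1) (a i) (b i) =
        ∑ c : ∀ i, Fin (p i), (∏ i, (x i).1 (a i) (c i)) * ∏ i, (y i).1 (c i) (b i)
      simp only [Matrix.mul_apply, Finset.prod_univ_sum, Fintype.piFinset_univ,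
        Finset.prod_mul_distrib])

theorem kronecker_tprod (f : ∀ i, triangular R (I i) (p i)) (a b : ∀ i, Fin (p i)) :
    kronecker I p (PiTensorProduct.tprod R f) a b = ∏ i, (f i).1 (a i) (b i) := by
  rw [kronecker, PiTensorProduct.liftAlgHom_apply, PiTensorProduct.lift.tprod]
  rfl

/-- If the ideals are generated by nonzero elements of a domain, then the tensor product is free on
products of matrix units, and the entries of the Kronecker product are nonzero multiples of the
coordinates. -/
theorem kronecker_eq_repr [IsDomain R] {γ : Fin n → R} (hI : ∀ i, I i = Ideal.span {γ i})
    (hγ : ∀ i, γ i ≠ 0) (z : ⨂[R] i, triangular R (I i) (p i)) (a b : ∀ i, Fin (p i)) :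
    kronecker I p z a b = (Basis.piTensorProduct
      fun i => triangularBasis (hI i) (hγ i) (p i)).repr z (fun i => (a i, b i)) *
        prodGen γ a b := by
  induction z using PiTensorProduct.induction_on with
  | smul_tprod r f =>
    rw [map_smul, Matrix.smul_apply, kronecker_tprod, map_smul, Finsupp.smul_apply,
      Basis.piTensorProduct_repr_tprod_apply, smul_mul_assoc, prodGen, ← Finset.prod_mul_distrib]
    congr 1
    exact Finset.prod_congr rfl fun i _ => (triangularBasis_repr (hI i) (hγ i) (p i) _ _ _).symm
  | add x y hx hy =>
    rw [map_add, Matrix.add_apply, hx, hy, map_add, Finsupp.add_apply, add_mul]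

theorem kronecker_injective [IsDomain R] {γ : Fin n → R} (hI : ∀ i, I i = Ideal.span {γ i})
    (hγ : ∀ i, γ i ≠ 0) : Function.Injective (kronecker I p) := by
  rw [injective_iff_map_eq_zero]
  intro z hz
  refine (Basis.piTensorProduct fun i => triangularBasis (hI i) (hγ i) (p i)).repr.map_eq_zero_iff.1
    (Finsupp.ext fun ab => ?_)
  have h := kronecker_eq_repr hI hγ z (fun i => (ab i).1) (fun i => (ab i).2)
  rw [hz, Matrix.zero_apply] at h
  exact (mul_eq_zero.1 h.symm).resolve_right (prodGen_ne_zero hγ _ _)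

theorem prodGen_dvd_kronecker [IsDomain R] {γ : Fin n → R} (hI : ∀ i, I i = Ideal.span {γ i})
    (hγ : ∀ i, γ i ≠ 0) (z : ⨂[R] i, triangular R (I i) (p i)) (a b : ∀ i, Fin (p i)) :
    prodGen γ a b ∣ kronecker I p z a b :=
  ⟨_, (kronecker_eq_repr hI hγ z a b).trans (mul_comm _ _)⟩

end TensorMatrix

/-! ### Stalks of the structure sheaf and of the ideals of the hyperplanes -/

section Stalks

variable {k : Type u} [Field k] {d n : ℕ}

instance (x : projSpace k d) : IsDomain (polyLoc x) :=
  IsLocalization.isDomain_localization (primeAt x).primeCompl_le_nonZeroDivisors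

/-- The germ of the fraction `u / v`, for `u` and `v` of the same degree. -/
def germ (x : projSpace k d) (e : ℕ) (u v : polyGrading k d e) (hv : v.1 ∉ primeAt x) : OStalk x :=
  HomogeneousLocalization.mk ⟨e, u, v, hv⟩

theorem algebraMap_germ (x : projSpace k d) (e : ℕ) (u v : polyGrading k d e)
    (hv : v.1 ∉ primeAt x) :
    algebraMap (OStalk x) (polyLoc x) (germ x e u v hv) = Localization.mk u.1 ⟨v.1, hv⟩ :=
  rfl

theorem exists_germ_eq (x : projSpace k d) (z : OStalk x) :
    ∃ (e : ℕ) (u v : polyGrading k d e) (hv : v.1 ∉ primeAt x), z = germ x e u v hv := by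
  obtain ⟨c, rfl⟩ := HomogeneousLocalization.mk_surjective z
  exact ⟨c.deg, c.num, c.den, c.den_mem, rfl⟩

theorem algebraMap_OStalk_injective (x : projSpace k d) :
    Function.Injective (algebraMap (OStalk x) (polyLoc x)) :=
  HomogeneousLocalization.val_injective _

instance (x : projSpace k d) : IsDomain (OStalk x) :=
  (algebraMap_OStalk_injective x).isDomain (algebraMap (OStalk x) (polyLoc x))

instance (x : projSpace k d) : IsScalarTower k (OStalk x) (polyLoc x) :=
  IsScalarTower.of_algebraMap_eq fun c =>
    (IsScalarTower.algebraMap_apply k (MvPolynomial (Fin (d + 1)) k) (polyLoc x) c).trans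
      (Localization.mk_one_eq_algebraMap _).symm

variable (coef : Fin n → Fin (d + 1) → k)

theorem linearForm_mem (i : Fin n) : linearForm coef i ∈ polyGrading k d 1 :=
  sum_mem fun j _ => by
    have := (MvPolynomial.isHomogeneous_C (Fin (d + 1)) (coef i j)).mul
      (MvPolynomial.isHomogeneous_X k j)
    rwa [zero_add] at this

/-- The equation `ℓ_i / T_j` of the hyperplane `L_i` at a point where `T_j` does not vanish. -/
def formGerm (i : Fin n) (j : Fin (d + 1)) (x : projSpace k d)
    (hj : (MvPolynomial.X j : MvPolynomial (Fin (d + 1)) k) ∉ primeAt x) : OStalk x :=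
  germ x 1 ⟨_, linearForm_mem coef i⟩ ⟨_, MvPolynomial.isHomogeneous_X k j⟩ hj

theorem algebraMap_formGerm (i : Fin n) (j : Fin (d + 1)) (x : projSpace k d)
    (hj : (MvPolynomial.X j : MvPolynomial (Fin (d + 1)) k) ∉ primeAt x) :
    algebraMap (OStalk x) (polyLoc x) (formGerm coef i j x hj) *
      algebraMap (MvPolynomial (Fin (d + 1)) k) (polyLoc x) (MvPolynomial.X j) =
        algebraMap (MvPolynomial (Fin (d + 1)) k) (polyLoc x) (linearForm coef i) := by
  rw [formGerm, algebraMap_germ, Localization.mk_eq_mk']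
  exact IsLocalization.mk'_spec (M := (primeAt x).primeCompl) (polyLoc x) (linearForm coef i)
    (⟨MvPolynomial.X j, hj⟩ : (primeAt x).primeCompl)

theorem formGerm_ne_zero {i : Fin n} (hi : linearForm coef i ≠ 0) (j : Fin (d + 1))
    (x : projSpace k d) (hj : (MvPolynomial.X j : MvPolynomial (Fin (d + 1)) k) ∉ primeAt x) :
    formGerm coef i j x hj ≠ 0 := by
  intro h
  have h1 := algebraMap_formGerm coef i j x hj
  rw [h, map_zero, zero_mul] at h1
  exact hi (IsLocalization.injective (polyLoc x) (primeAt x).primeCompl_le_nonZeroDivisors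
    (h1.symm.trans (map_zero _).symm))

/-- The ideal sheaf of a hyperplane is locally principal. A germ divisible by `ℓ_i` in the whole
localization `S_x` is divisible by `ℓ_i / T_j` in degree `0`: take homogeneous components. -/
theorem idealStalk_eq_span (i : Fin n) (j : Fin (d + 1))
    (x : projSpace k d) (hj : (MvPolynomial.X j : MvPolynomial (Fin (d + 1)) k) ∉ primeAt x) :
    idealStalk coef i x = Ideal.span {formGerm coef i j x hj} := by
  have hS := IsLocalization.injective (polyLoc x) (primeAt x).primeCompl_le_nonZeroDivisors
  have hXu := IsLocalization.map_units (polyLoc x) (⟨_, hj⟩ : (primeAt x).primeCompl)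
  apply le_antisymm
  · intro z hz
    obtain ⟨w, hw⟩ := Ideal.mem_span_singleton'.1 (Ideal.mem_comap.1 hz)
    obtain ⟨e, a, b, hb, rfl⟩ := exists_germ_eq x z
    obtain ⟨u, v, rfl⟩ := IsLocalization.exists_mk'_eq (primeAt x).primeCompl w
    rw [algebraMap_germ, Localization.mk_eq_mk', ← IsLocalization.mk'_one (M := (primeAt x).primeCompl)
      (polyLoc x) (linearForm coef i), ← IsLocalization.mk'_mul, IsLocalization.mk'_eq_iff_eq] at hw
    have hva : v.1 * a.1 = u * (linearForm coef i * b.1) := by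
      have h := hS hw
      rw [mul_one] at h
      rw [← h, mul_left_comm, mul_comm (linearForm coef i)]
    obtain ⟨r, hr⟩ := exists_decompose_notMem x v.2
    have hl : (DirectSum.decompose (polyGrading k d) (v.1 * a.1) (r + e) :
        MvPolynomial (Fin (d + 1)) k) = _ :=
      DirectSum.coe_decompose_mul_add_of_right_mem (polyGrading k d) a.2
    have hlb : linearForm coef i * b.1 ∈ polyGrading k d (1 + e) :=
      SetLike.mul_mem_graded (linearForm_mem coef i) b.2
    rw [hva] at hl
    rcases r with - | s
    · rw [DirectSum.coe_decompose_mul_of_right_mem_of_not_le _ hlb (by omega)] at hl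
      have ha : a = 0 := Subtype.ext ((mul_eq_zero.1 hl.symm).resolve_left
        fun h => hr (h ▸ zero_mem _))
      have : germ x e a b hb = 0 := algebraMap_OStalk_injective x (by
        rw [algebraMap_germ, ha, map_zero]
        exact Localization.mk_zero _)
      rw [this]
      exact zero_mem _
    · rw [show s + 1 + e = s + (1 + e) by omega,
        DirectSum.coe_decompose_mul_add_of_right_mem _ hlb] at hl
      refine Ideal.mem_span_singleton'.2 ⟨germ x (s + 1)
        ⟨(DirectSum.decompose (polyGrading k d) u s : MvPolynomial (Fin (d + 1)) k) *
          MvPolynomial.X j,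
          SetLike.mul_mem_graded (SetLike.coe_mem _) (MvPolynomial.isHomogeneous_X k j)⟩
        (DirectSum.decompose (polyGrading k d) v.1 (s + 1)) hr, ?_⟩
      refine algebraMap_OStalk_injective x ?_
      rw [map_mul, formGerm, algebraMap_germ, algebraMap_germ, algebraMap_germ,
        Localization.mk_mul, Localization.mk_eq_mk_iff, Localization.r_iff_exists]
      refine ⟨1, ?_⟩
      change (1 : MvPolynomial (Fin (d + 1)) k) * (b.1 * (_ * MvPolynomial.X j * linearForm coef i)) =
        1 * (_ * MvPolynomial.X j * a.1)
      linear_combination MvPolynomial.X j * hl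
  · rw [Ideal.span_singleton_le_iff_mem, idealStalk, Ideal.mem_comap, Ideal.mem_span_singleton']
    refine ⟨(hXu.unit⁻¹ : (polyLoc x)ˣ), ?_⟩
    rw [Units.inv_mul_eq_iff_eq_mul, ← algebraMap_formGerm coef i j x hj, mul_comm]
    rfl

end Stalks

/-! ### Matrices attached to germs of the tensor ring -/

section TensorRing

open MulOpposite

variable (k Λ N : Type u) [Field k] [Ring Λ] [Algebra k Λ] [AddCommGroup N] [Module k N]
  [Module Λ N] [Module Λᵐᵒᵖ N]

namespace TensorRing

variable {k Λ N} {A : Type u} [Ring A] [Algebra k A]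

/-- The universal property of the tensor ring. -/
def lift (f : Λ →ₐ[k] A) (g : N →ₗ[k] A) (hl : ∀ a m, g (a • m) = f a * g m)
    (hr : ∀ m a, g (op a • m) = g m * f a) : TensorRing k Λ N →ₐ[k] A :=
  RingQuot.liftAlgHom k ⟨TensorAlgebra.lift k (f.toLinearMap.coprod g), by
    rintro _ _ (_ | ⟨a, b⟩ | ⟨a, m⟩ | ⟨m, a⟩) <;>
      simp [hl, hr]⟩

variable (f : Λ →ₐ[k] A) (g : N →ₗ[k] A) (hl : ∀ a m, g (a • m) = f a * g m)
    (hr : ∀ m a, g (op a • m) = g m * f a)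

theorem lift_ofPair (z : Λ × N) : lift f g hl hr (ofPair k Λ N z) = f z.1 + g z.2 :=
  (RingQuot.liftAlgHom_mkAlgHom_apply _ _ _ _).trans (TensorAlgebra.lift_ι_apply _ _)

@[simp]
theorem lift_ofRing (a : Λ) : lift f g hl hr (ofRing k Λ N a) = f a :=
  (lift_ofPair f g hl hr (a, 0)).trans (by rw [map_zero, add_zero])

@[simp]
theorem lift_ofModule (m : N) : lift f g hl hr (ofModule k Λ N m) = g m :=
  (lift_ofPair f g hl hr (0, m)).trans (by rw [map_zero, zero_add])

variable (k Λ N) in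
/-- The degree `l` part of the tensor ring. -/
def degPart (l : ℕ) : Submodule k (TensorRing k Λ N) :=
  LinearMap.range (ofRing k Λ N).toLinearMap * LinearMap.range (ofModule k Λ N) ^ l

/-- If `N` is generated by an element `τ` commuting with `Λ`, then all elements of degree `l` are of the
form `a τ^l`. -/
theorem exists_eq_mul_pow (τ : N) (hτ : ∀ a : Λ, op a • τ = a • τ) (hgen : ∀ m : N, ∃ a : Λ, m = a • τ)
    (l : ℕ) {z : TensorRing k Λ N} (hz : z ∈ degPart k Λ N l) :
    ∃ a, z = ofRing k Λ N a * ofModule k Λ N τ ^ l := by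
  have hcomm : ∀ (l : ℕ) (a : Λ), ofModule k Λ N τ ^ l * ofRing k Λ N a =
      ofRing k Λ N a * ofModule k Λ N τ ^ l := by
    intro l a
    have h : Commute (ofModule k Λ N τ) (ofRing k Λ N a) := by
      rw [commute_iff_eq, ← ofModule_op_smul, hτ, ofModule_smul]
    exact (h.pow_left l).eq
  let P : ℕ → Submodule k (TensorRing k Λ N) := fun l =>
    (LinearMap.range (ofRing k Λ N).toLinearMap).map (LinearMap.mulRight k (ofModule k Λ N τ ^ l))
  have hP : ∀ l, degPart k Λ N l ≤ P l := by
    intro l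
    induction l with
    | zero =>
      rw [degPart, pow_zero, mul_one]
      rintro z hz
      exact ⟨z, hz, by simp⟩
    | succ l ih =>
      rw [degPart, pow_succ, ← mul_assoc, Submodule.mul_le]
      rintro y hy _ ⟨m, rfl⟩
      obtain ⟨_, ⟨a, rfl⟩, rfl⟩ := ih hy
      obtain ⟨b, rfl⟩ := hgen m
      refine ⟨_, ⟨a * b, rfl⟩, ?_⟩
      simp only [LinearMap.mulRight_apply, AlgHom.toLinearMap_apply, map_mul, ofModule_smul,
        pow_succ]
      rw [mul_assoc, ← mul_assoc (ofRing k Λ N b), ← hcomm]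
      simp only [mul_assoc]
  obtain ⟨_, ⟨a, rfl⟩, rfl⟩ := hP l hz
  exact ⟨a, rfl⟩

end TensorRing

end TensorRing

section StalkMatrix

variable {k : Type u} [Field k] {d n : ℕ} (coef : Fin n → Fin (d + 1) → k) (p : Fin n → ℕ)

/-- The index set of the rows and columns of the tensor product of the `Λ_i`. -/
abbrev Idx : Type := ∀ i : Fin n, Fin (p i)

/-- The embedding of the stalk of `Λ` in a matrix ring over `S_x`, by Kronecker products. -/
def orderMatrix (x : projSpace k d) :
    OrderStalk coef p x →ₐ[OStalk x] Matrix (Idx p) (Idx p) (polyLoc x) :=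
  (Algebra.ofId (OStalk x) (polyLoc x)).mapMatrix.comp
    (kronecker (fun i => idealStalk coef i x) p)

variable {coef p} in
/-- The germ `f_1 ⊗ ⋯ ⊗ f_n` of `Λ`. -/
def OrderStalk.tprod {x : projSpace k d} (f : ∀ i, FactorStalk coef p i x) : OrderStalk coef p x :=
  PiTensorProduct.tprod (OStalk x) f

theorem orderMatrix_tprod (x : projSpace k d) (f : ∀ i, FactorStalk coef p i x) (a b : Idx p) :
    orderMatrix coef p x (OrderStalk.tprod f) a b =
      ∏ i, algebraMap (OStalk x) (polyLoc x) ((f i).1 (a i) (b i)) :=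
  (congrArg _ (kronecker_tprod f a b)).trans (map_prod (algebraMap (OStalk x) (polyLoc x)) _ _)

/-- The embedding of the stalk of `L` in a matrix ring over `S_x`, which multiplies the matrix of a
germ of `Λ` by a germ of `𝒪(1)`. -/
def twistMatrix (x : projSpace k d) :
    LStalk coef p x →ₗ[OStalk x] Matrix (Idx p) (Idx p) (polyLoc x) :=
  TensorProduct.lift (LinearMap.mk₂ (OStalk x)
    (fun (a : OrderStalk coef p x) (t : O1Stalk x) => (t : polyLoc x) • orderMatrix coef p x a)
    (fun a b t => by rw [map_add, smul_add])
    (fun c a t => by rw [map_smul, smul_comm])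
    (fun a s t => by rw [Submodule.coe_add, add_smul])
    (fun c a t => by rw [Submodule.coe_smul, smul_assoc]))

variable {coef p} in
/-- The germ `a ⊗ t` of `L`. -/
def LStalk.tmul {x : projSpace k d} (a : OrderStalk coef p x) (t : O1Stalk x) : LStalk coef p x :=
  a ⊗ₜ[OStalk x] t

variable {coef p} in
theorem LStalk.induction {x : projSpace k d} {P : LStalk coef p x → Prop} (zero : P 0)
    (tmul : ∀ a t, P (LStalk.tmul a t)) (add : ∀ m m', P m → P m' → P (m + m'))
    (m : LStalk coef p x) : P m :=
  TensorProduct.induction_on m zero tmul add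

theorem LStalk.smul_tmul {x : projSpace k d} (a b : OrderStalk coef p x) (t : O1Stalk x) :
    a • LStalk.tmul b t = LStalk.tmul (a * b) t :=
  rfl

theorem LStalk.op_smul_tmul {x : projSpace k d} (a b : OrderStalk coef p x) (t : O1Stalk x) :
    MulOpposite.op a • LStalk.tmul b t = LStalk.tmul (b * a) t :=
  rfl

theorem twistMatrix_tmul (x : projSpace k d) (a : OrderStalk coef p x) (t : O1Stalk x) :
    twistMatrix coef p x (LStalk.tmul a t) = (t : polyLoc x) • orderMatrix coef p x a :=
  TensorProduct.lift.tmul _ _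

theorem twistMatrix_smul (x : projSpace k d) (a : OrderStalk coef p x) (m : LStalk coef p x) :
    twistMatrix coef p x (a • m) = orderMatrix coef p x a * twistMatrix coef p x m := by
  induction m using LStalk.induction with
  | zero => rw [smul_zero, map_zero, mul_zero]
  | tmul b t =>
    rw [LStalk.smul_tmul, twistMatrix_tmul, twistMatrix_tmul, map_mul, mul_smul_comm]
  | add m m' h h' => rw [smul_add, map_add, map_add, mul_add, h, h']

theorem twistMatrix_op_smul (x : projSpace k d) (m : LStalk coef p x) (a : OrderStalk coef p x) :
    twistMatrix coef p x (MulOpposite.op a • m) =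
      twistMatrix coef p x m * orderMatrix coef p x a := by
  induction m using LStalk.induction with
  | zero => rw [smul_zero, map_zero, zero_mul]
  | tmul b t =>
    rw [LStalk.op_smul_tmul, twistMatrix_tmul, twistMatrix_tmul, map_mul, smul_mul_assoc]
  | add m m' h h' => rw [smul_add, map_add, map_add, add_mul, h, h']

instance (x : projSpace k d) : IsScalarTower k (OStalk x) (OrderStalk coef p x) :=
  IsScalarTower.of_algebraMap_smul fun _ _ => rfl

instance (x : projSpace k d) : IsScalarTower k (OStalk x) (LStalk coef p x) :=
  IsScalarTower.of_algebraMap_smul fun _ _ => rfl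

/-- The homomorphism from the stalk of the tensor ring of `L` to a matrix ring over `S_x`. -/
def locMatrix (x : projSpace k d) : TStalk coef p x →ₐ[k] Matrix (Idx p) (Idx p) (polyLoc x) :=
  TensorRing.lift ((orderMatrix coef p x).restrictScalars k)
    ((twistMatrix coef p x).restrictScalars k)
    (twistMatrix_smul coef p x) (twistMatrix_op_smul coef p x)

@[simp]
theorem locMatrix_ofRing (x : projSpace k d) (a : OrderStalk coef p x) :
    locMatrix coef p x (TensorRing.ofRing k _ _ a) = orderMatrix coef p x a :=
  TensorRing.lift_ofRing _ _ _ _ a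

@[simp]
theorem locMatrix_ofModule (x : projSpace k d) (m : LStalk coef p x) :
    locMatrix coef p x (TensorRing.ofModule k _ _ m) = twistMatrix coef p x m :=
  TensorRing.lift_ofModule _ _ _ _ m

end StalkMatrix

/-! ### Matrices over a common field -/

section FieldMatrix

variable {k : Type u} [Field k] {d n : ℕ}

variable (k) in
theorem X_mem (j : Fin (d + 1)) : MvPolynomial.X j ∈ polyGrading k d 1 :=
  MvPolynomial.isHomogeneous_X k j

section ToField

variable (Ω : Type u) [Field Ω] [Algebra k Ω] [Algebra (MvPolynomial (Fin (d + 1)) k) Ω]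
  [IsScalarTower k (MvPolynomial (Fin (d + 1)) k) Ω] [FaithfulSMul (MvPolynomial (Fin (d + 1)) k) Ω]

/-- The embedding of `S_x` in a field `Ω` containing the polynomial ring `S`. -/
def toField (x : projSpace k d) : polyLoc x →ₐ[k] Ω :=
  IsLocalization.liftAlgHom (M := (primeAt x).primeCompl)
    (f := IsScalarTower.toAlgHom k (MvPolynomial (Fin (d + 1)) k) Ω) fun v =>
      ((map_ne_zero_iff _ (FaithfulSMul.algebraMap_injective (MvPolynomial (Fin (d + 1)) k) Ω)).2
        (ne_of_mem_of_not_mem (zero_mem (primeAt x)) v.2).symm).isUnit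

@[simp]
theorem toField_algebraMap (x : projSpace k d) (u : MvPolynomial (Fin (d + 1)) k) :
    toField Ω x (algebraMap _ (polyLoc x) u) = algebraMap _ Ω u :=
  IsLocalization.lift_eq _ u

theorem toField_mk (x : projSpace k d) (u v : MvPolynomial (Fin (d + 1)) k) (hv : v ∉ primeAt x) :
    toField Ω x (Localization.mk u ⟨v, hv⟩) * algebraMap _ Ω v = algebraMap _ Ω u := by
  rw [← toField_algebraMap Ω x v, ← toField_algebraMap Ω x u, ← map_mul, Localization.mk_eq_mk']
  exact congrArg _ (IsLocalization.mk'_spec (polyLoc x) u (⟨v, hv⟩ : (primeAt x).primeCompl))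

theorem toField_injective (x : projSpace k d) : Function.Injective (toField Ω x) := by
  rw [injective_iff_map_eq_zero]
  intro z hz
  obtain ⟨u, v, rfl⟩ := IsLocalization.exists_mk'_eq (primeAt x).primeCompl z
  have h := toField_mk Ω x u v.1 v.2
  rw [Localization.mk_eq_mk', hz, zero_mul] at h
  have : u = 0 := FaithfulSMul.algebraMap_injective (MvPolynomial (Fin (d + 1)) k) Ω
    (h.symm.trans (map_zero _).symm)
  rw [this, IsLocalization.mk'_zero]

end ToField

/-- The germ at `x` of the section of `𝒪(1)` given by a linear form. -/
def linearGerm {m : MvPolynomial (Fin (d + 1)) k} (hm : m ∈ polyGrading k d 1) (x : projSpace k d) :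
    O1Stalk x :=
  ⟨algebraMap _ (polyLoc x) m, 0, ⟨m, hm⟩, ⟨1, SetLike.GradedOne.one_mem⟩, one_mem _,
    (Localization.mk_one_eq_algebraMap m).symm⟩

theorem exists_smul_linearGerm (x : projSpace k d) {j : Fin (d + 1)}
    (hj : (MvPolynomial.X j : MvPolynomial (Fin (d + 1)) k) ∉ primeAt x) (t : O1Stalk x) :
    ∃ c : OStalk x, t = c • linearGerm (X_mem k j) x := by
  obtain ⟨t, e, a, b, hb, rfl⟩ := t
  refine ⟨germ x (e + 1) a ⟨b.1 * MvPolynomial.X j, SetLike.mul_mem_graded b.2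
    (X_mem k j)⟩ (fun h => (Ideal.IsPrime.mem_or_mem inferInstance h).elim hb hj),
    Subtype.ext ?_⟩
  rw [Submodule.coe_smul, Algebra.smul_def, algebraMap_germ]
  change _ = _ * algebraMap _ (polyLoc x) (MvPolynomial.X j)
  rw [← Localization.mk_one_eq_algebraMap, Localization.mk_mul, Localization.mk_eq_mk_iff,
    Localization.r_iff_exists]
  refine ⟨1, ?_⟩
  change (1 : MvPolynomial (Fin (d + 1)) k) * (b.1 * MvPolynomial.X j * 1 * a.1) =
    1 * (b.1 * (a.1 * MvPolynomial.X j))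
  ring

variable (coef : Fin n → Fin (d + 1) → k) (p : Fin n → ℕ)

/-- The germ at `x` of the section of `L` given by a linear form. -/
def linearL {m : MvPolynomial (Fin (d + 1)) k} (hm : m ∈ polyGrading k d 1) (x : projSpace k d) :
    LStalk coef p x :=
  LStalk.tmul 1 (linearGerm hm x)

theorem smul_linearL {m : MvPolynomial (Fin (d + 1)) k} (hm : m ∈ polyGrading k d 1)
    (x : projSpace k d) (a : OrderStalk coef p x) :
    a • linearL coef p hm x = LStalk.tmul a (linearGerm hm x) :=
  congrArg (fun b => LStalk.tmul b (linearGerm hm x)) (mul_one a)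

theorem op_smul_linearL {m : MvPolynomial (Fin (d + 1)) k} (hm : m ∈ polyGrading k d 1)
    (x : projSpace k d) (a : OrderStalk coef p x) :
    MulOpposite.op a • linearL coef p hm x = LStalk.tmul a (linearGerm hm x) :=
  congrArg (fun b => LStalk.tmul b (linearGerm hm x)) (one_mul a)

theorem twistMatrix_linearL {m : MvPolynomial (Fin (d + 1)) k} (hm : m ∈ polyGrading k d 1)
    (x : projSpace k d) :
    twistMatrix coef p x (linearL coef p hm x) = algebraMap _ (polyLoc x) m • 1 := by
  rw [linearL, twistMatrix_tmul, map_one]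
  rfl

/-- Where `T_j` does not vanish, elements of degree `l` of the tensor ring are of the form `a T_j ^ l`
with `a` in `Λ`. -/
theorem exists_eq_mul_linearL_pow (x : projSpace k d) {j : Fin (d + 1)}
    (hj : (MvPolynomial.X j : MvPolynomial (Fin (d + 1)) k) ∉ primeAt x) {l : ℕ}
    {z : TStalk coef p x} (hz : z ∈ TensorRing.degPart k (OrderStalk coef p x) (LStalk coef p x) l) :
    ∃ a, z = TensorRing.ofRing k _ _ a *
      TensorRing.ofModule k _ _ (linearL coef p (X_mem k j) x) ^ l := by
  refine TensorRing.exists_eq_mul_pow _ (fun a => ?_) (fun m => ?_) l hz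
  · exact (op_smul_linearL coef p _ x a).trans (smul_linearL coef p _ x a).symm
  · induction m using LStalk.induction with
    | zero => exact ⟨0, (zero_smul _ _).symm⟩
    | tmul b t =>
      obtain ⟨c, rfl⟩ := exists_smul_linearGerm x hj t
      exact ⟨c • b, (TensorProduct.smul_tmul c b _).symm.trans (smul_linearL coef p _ x _).symm⟩
    | add m m' h h' =>
      obtain ⟨a, rfl⟩ := h
      obtain ⟨a', rfl⟩ := h'
      exact ⟨a + a', (add_smul _ _ _).symm⟩

theorem locMatrix_mul_linearL_pow (x : projSpace k d) (j : Fin (d + 1)) (l : ℕ)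
    (a : OrderStalk coef p x) :
    locMatrix coef p x (TensorRing.ofRing k _ _ a *
      TensorRing.ofModule k _ _ (linearL coef p (X_mem k j) x) ^ l) =
      algebraMap (MvPolynomial (Fin (d + 1)) k) (polyLoc x) (MvPolynomial.X j ^ l) •
        orderMatrix coef p x a := by
  rw [map_mul, map_pow, locMatrix_ofRing, locMatrix_ofModule, twistMatrix_linearL, smul_pow,
    one_pow, mul_smul_comm, mul_one, map_pow]

variable (Ω : Type u) [Field Ω] [Algebra k Ω] [Algebra (MvPolynomial (Fin (d + 1)) k) Ω]
  [IsScalarTower k (MvPolynomial (Fin (d + 1)) k) Ω] [FaithfulSMul (MvPolynomial (Fin (d + 1)) k) Ω]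

/-- The homomorphism from the stalk of the tensor ring of `L` to a matrix ring over `Ω`. -/
def fieldMatrix (x : projSpace k d) : TStalk coef p x →ₐ[k] Matrix (Idx p) (Idx p) Ω :=
  (toField Ω x).mapMatrix.comp (locMatrix coef p x)

theorem fieldMatrix_apply (x : projSpace k d) (z : TStalk coef p x) (a b : Idx p) :
    fieldMatrix coef p Ω x z a b = toField Ω x (locMatrix coef p x z a b) :=
  rfl

theorem orderMatrix_injective (hℓ : ∀ i, linearForm coef i ≠ 0) (x : projSpace k d) :
    Function.Injective (orderMatrix coef p x) := by
  obtain ⟨j, hj⟩ := exists_X_notMem x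
  have h : Function.Injective (kronecker (fun i => idealStalk coef i x) p) :=
    kronecker_injective (fun i => idealStalk_eq_span coef i j x hj)
      fun i => formGerm_ne_zero coef (hℓ i) j x hj
  exact (Matrix.map_injective (algebraMap_OStalk_injective x)).comp h

/-- A germ of degree `l` is determined by its matrix: write it as `a T_j ^ l` with `a` in `Λ`, and use
that `T_j` is a unit and that `Λ` is embedded in matrices. -/
theorem eq_zero_of_fieldMatrix_eq_zero (hℓ : ∀ i, linearForm coef i ≠ 0) (x : projSpace k d)
    {l : ℕ} {z : TStalk coef p x}
    (hz : z ∈ TensorRing.degPart k (OrderStalk coef p x) (LStalk coef p x) l)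
    (h : fieldMatrix coef p Ω x z = 0) : z = 0 := by
  obtain ⟨j, hj⟩ := exists_X_notMem x
  obtain ⟨a, rfl⟩ := exists_eq_mul_linearL_pow coef p x hj hz
  have h1 : locMatrix coef p x _ = 0 :=
    Matrix.map_injective (toField_injective Ω x) (h.trans (Matrix.map_zero _ (map_zero _)).symm)
  rw [locMatrix_mul_linearL_pow] at h1
  have hu : IsUnit (algebraMap (MvPolynomial (Fin (d + 1)) k) (polyLoc x) (MvPolynomial.X j ^ l)) :=
    IsLocalization.map_units (polyLoc x) (⟨_, hj⟩ ^ l : (primeAt x).primeCompl)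
  have h2 : a = 0 := orderMatrix_injective coef p hℓ x
    ((hu.smul_eq_zero.1 h1).trans (map_zero _).symm)
  rw [h2, map_zero, zero_mul]

/-- The entries of the matrix of a germ of degree `l` are divisible by the products of the `ℓ_i` over the
`i` where the index is above the diagonal, and the quotient is a fraction of forms whose denominator
does not vanish at the point. -/
theorem exists_fieldMatrix_eq (hℓ : ∀ i, linearForm coef i ≠ 0) (x : projSpace k d)
    {l : ℕ} {z : TStalk coef p x}
    (hz : z ∈ TensorRing.degPart k (OrderStalk coef p x) (LStalk coef p x) l) (a b : Idx p) :
    ∃ (e : ℕ) (u v : MvPolynomial (Fin (d + 1)) k), u ∈ polyGrading k d (e + l) ∧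
      v ∈ polyGrading k d (e + numAbove a b) ∧ v ∉ primeAt x ∧
      fieldMatrix coef p Ω x z a b * algebraMap _ Ω v =
        algebraMap _ Ω (prodGen (linearForm coef) a b * u) := by
  obtain ⟨j, hj⟩ := exists_X_notMem x
  obtain ⟨c, rfl⟩ := exists_eq_mul_linearL_pow coef p x hj hz
  obtain ⟨r, hr⟩ := prodGen_dvd_kronecker (fun i => idealStalk_eq_span coef i j x hj)
    (fun i => formGerm_ne_zero coef (hℓ i) j x hj) c a b
  obtain ⟨e, f, g, hg, rfl⟩ := exists_germ_eq x r
  have hX := MvPolynomial.isHomogeneous_X k j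
  have hXl : ∀ l, (MvPolynomial.X j ^ l : MvPolynomial (Fin (d + 1)) k) ∈ polyGrading k d l := by
    intro l
    have := hX.pow l
    rwa [one_mul] at this
  refine ⟨e, f.1 * MvPolynomial.X j ^ l, g.1 * MvPolynomial.X j ^ numAbove a b,
    SetLike.mul_mem_graded f.2 (hXl _), SetLike.mul_mem_graded g.2 (hXl _),
    fun h => (Ideal.IsPrime.mem_or_mem inferInstance h).elim hg
      fun h => hj (Ideal.IsPrime.mem_of_pow_mem inferInstance _ h), ?_⟩
  have h1 : orderMatrix coef p x c a b = algebraMap (OStalk x) (polyLoc x) _ :=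
    congrArg (algebraMap (OStalk x) (polyLoc x)) hr
  have h2 := toField_mk Ω x f.1 g.1 hg
  have h3 : toField Ω x (prodGen (fun i => algebraMap (OStalk x) (polyLoc x)
      (formGerm coef i j x hj)) a b) *
        algebraMap (MvPolynomial (Fin (d + 1)) k) Ω (MvPolynomial.X j ^ numAbove a b) =
      algebraMap _ Ω (prodGen (linearForm coef) a b) := by
    rw [← toField_algebraMap Ω x (MvPolynomial.X j ^ _), ← map_mul, map_pow, ← prodGen_mul_const]
    simp only [algebraMap_formGerm]
    rw [← map_prodGen, toField_algebraMap]
  rw [fieldMatrix_apply, locMatrix_mul_linearL_pow, Matrix.smul_apply, h1, map_mul, map_prodGen,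
    algebraMap_germ, smul_eq_mul, map_mul, toField_algebraMap, map_mul, map_mul, map_mul, map_mul,
    ← h2, ← h3]
  ring

end FieldMatrix

/-! ### Global sections -/

section Sections

variable {k : Type u} [Field k] {d n : ℕ}

/-- A locally constant family on an open set of `ℙ^d` is constant, since all nonempty open sets
contain the generic point. -/
theorem eq_of_locally_eq {X : Type*} {U : Opens (projSpace k d)} (F : U → X)
    (h : ∀ x : U, ∃ V : Opens (projSpace k d), x.1 ∈ V ∧ ∃ i : V ⟶ U, ∀ y z : V, F (i y) = F (i z))
    (x y : U) : F x = F y := by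
  have key : ∀ x : U, F x = F ⟨genericPoint k d, genericPoint_mem x.1 x.2⟩ := by
    intro x
    obtain ⟨V, hx, i, hV⟩ := h x
    exact hV ⟨x.1, hx⟩ ⟨genericPoint k d, genericPoint_mem x.1 hx⟩
  exact (key x).trans (key y).symm

variable (coef : Fin n → Fin (d + 1) → k) (p : Fin n → ℕ)
  (Ω : Type u) [Field Ω] [Algebra k Ω] [Algebra (MvPolynomial (Fin (d + 1)) k) Ω]
  [IsScalarTower k (MvPolynomial (Fin (d + 1)) k) Ω] [FaithfulSMul (MvPolynomial (Fin (d + 1)) k) Ω]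

theorem toField_mk_eq (x y : projSpace k d) (u v : MvPolynomial (Fin (d + 1)) k)
    (hx : v ∉ primeAt x) (hy : v ∉ primeAt y) :
    toField Ω x (Localization.mk u ⟨v, hx⟩) = toField Ω y (Localization.mk u ⟨v, hy⟩) := by
  have hv : algebraMap (MvPolynomial (Fin (d + 1)) k) Ω v ≠ 0 :=
    (map_ne_zero_iff _ (FaithfulSMul.algebraMap_injective (MvPolynomial (Fin (d + 1)) k) Ω)).2
      (ne_of_mem_of_not_mem (zero_mem (primeAt x)) hx).symm
  exact mul_right_cancel₀ hv ((toField_mk Ω x u v hx).trans (toField_mk Ω y u v hy).symm)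

theorem toField_regular_eq {U : Opens (projSpace k d)} {f : ∀ x : U, OStalk x.1}
    (hf : f ∈ regular U) (x y : U) :
    toField Ω x.1 (algebraMap (OStalk x.1) (polyLoc x.1) (f x)) =
      toField Ω y.1 (algebraMap (OStalk y.1) (polyLoc y.1) (f y)) := by
  refine eq_of_locally_eq
    (fun x : U => toField Ω x.1 (algebraMap (OStalk x.1) (polyLoc x.1) (f x))) (fun x => ?_) x y
  obtain ⟨V, hx, i, e, r, s, hs, h⟩ := hf x
  refine ⟨V, hx, i, fun y z => ?_⟩
  have hV : ∀ y : V, algebraMap (OStalk y.1) (polyLoc y.1) (f (i y)) =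
      Localization.mk r.1 ⟨s.1, hs y⟩ := fun y => congrArg (algebraMap (OStalk y.1) (polyLoc y.1)) (h y)
  exact (congrArg _ (hV y)).trans ((toField_mk_eq Ω _ _ _ _ _ _).trans (congrArg _ (hV z)).symm)

theorem toField_twist_eq {U : Opens (projSpace k d)} {g : ∀ x : U, O1Stalk x.1}
    (hg : twist.pred g) (x y : U) :
    toField Ω x.1 (g x : polyLoc x.1) = toField Ω y.1 (g y : polyLoc y.1) := by
  refine eq_of_locally_eq (fun x : U => toField Ω x.1 (g x : polyLoc x.1)) (fun x => ?_) x y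
  obtain ⟨V, hx, i, e, r, s, hs, h⟩ := hg x
  refine ⟨V, hx, i, fun y z => ?_⟩
  exact (congrArg _ (h y)).trans ((toField_mk_eq Ω _ _ _ _ _ _).trans (congrArg _ (h z)).symm)

/-- The families of germs of the tensor ring whose matrix over `Ω` is constant. They form a subalgebra,
so it suffices to find the sections of `Λ` and of `L` in it. -/
def constSections (U : Opens (projSpace k d)) : Subalgebra k (∀ x : U, TStalk coef p x.1) :=
  ⨅ (x : U) (y : U), AlgHom.equalizer
    ((fieldMatrix coef p Ω x.1).comp (Pi.evalAlgHom k (fun x : U => TStalk coef p x.1) x))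
    ((fieldMatrix coef p Ω y.1).comp (Pi.evalAlgHom k (fun x : U => TStalk coef p x.1) y))

theorem mem_constSections {U : Opens (projSpace k d)} {f : ∀ x : U, TStalk coef p x.1} :
    f ∈ constSections coef p Ω U ↔
      ∀ x y : U, fieldMatrix coef p Ω x.1 (f x) = fieldMatrix coef p Ω y.1 (f y) := by
  simp only [constSections, Algebra.mem_iInf, AlgHom.mem_equalizer]
  rfl

theorem fieldMatrix_ofRing (x : projSpace k d) (s : OrderStalk coef p x) (a b : Idx p) :
    fieldMatrix coef p Ω x (TensorRing.ofRing k _ _ s) a b =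
      toField Ω x (orderMatrix coef p x s a b) := by
  rw [fieldMatrix_apply, locMatrix_ofRing]

theorem fieldMatrix_tprod (x : projSpace k d) (f : ∀ i, FactorStalk coef p i x) (a b : Idx p) :
    fieldMatrix coef p Ω x (TensorRing.ofRing k _ _ (OrderStalk.tprod f)) a b =
      ∏ i, toField Ω x (algebraMap (OStalk x) (polyLoc x) ((f i).1 (a i) (b i))) := by
  rw [fieldMatrix_ofRing, orderMatrix_tprod, map_prod]

theorem fieldMatrix_ofModule_tmul (x : projSpace k d) (s : OrderStalk coef p x) (t : O1Stalk x) :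
    fieldMatrix coef p Ω x (TensorRing.ofModule k _ _ (LStalk.tmul s t)) =
      toField Ω x (t : polyLoc x) • fieldMatrix coef p Ω x (TensorRing.ofRing k _ _ s) := by
  ext a b
  rw [fieldMatrix_apply, locMatrix_ofModule, twistMatrix_tmul, Matrix.smul_apply, smul_eq_mul,
    map_mul, Matrix.smul_apply, fieldMatrix_ofRing, smul_eq_mul]

theorem ofRing_orderPre_eq {U : Opens (projSpace k d)} {f : ∀ x : U, OrderStalk coef p x.1}
    (hf : f ∈ (orderPre coef p).sec U) (x y : U) :
    fieldMatrix coef p Ω x.1 (TensorRing.ofRing k _ _ (f x)) =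
      fieldMatrix coef p Ω y.1 (TensorRing.ofRing k _ _ (f y)) := by
  induction hf using Submodule.span_induction with
  | mem f hf =>
    obtain ⟨f, hf, rfl⟩ := hf
    ext a b
    have h := fun x : U => fieldMatrix_tprod coef p Ω x.1 (fun i => f i x) a b
    exact (h x).trans ((Finset.prod_congr rfl fun i _ =>
      toField_regular_eq Ω (hf i (a i) (b i)) x y).trans (h y).symm)
  | zero => simp only [Pi.zero_apply, map_zero]
  | add f g _ _ hf hg => simp only [Pi.add_apply, map_add, hf, hg]
  | smul c f _ hf => simp only [Pi.smul_apply, map_smul, hf]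

theorem ofRing_order_eq {U : Opens (projSpace k d)} {f : ∀ x : U, OrderStalk coef p x.1}
    (hf : f ∈ (order coef p).sec U) (x y : U) :
    fieldMatrix coef p Ω x.1 (TensorRing.ofRing k _ _ (f x)) =
      fieldMatrix coef p Ω y.1 (TensorRing.ofRing k _ _ (f y)) := by
  refine eq_of_locally_eq (fun x : U => fieldMatrix coef p Ω x.1 (TensorRing.ofRing k _ _ (f x)))
    (fun x => ?_) x y
  obtain ⟨V, hx, i, hV⟩ := hf x
  exact ⟨V, hx, i, ofRing_orderPre_eq coef p Ω hV⟩

theorem ofModule_LPre_eq {U : Opens (projSpace k d)} {f : ∀ x : U, LStalk coef p x.1}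
    (hf : f ∈ (LPre coef p).sec U) (x y : U) :
    fieldMatrix coef p Ω x.1 (TensorRing.ofModule k _ _ (f x)) =
      fieldMatrix coef p Ω y.1 (TensorRing.ofModule k _ _ (f y)) := by
  induction hf using Submodule.span_induction with
  | mem f hf =>
    obtain ⟨f, g, hf, hg, rfl⟩ := hf
    have h := fieldMatrix_ofModule_tmul coef p Ω
    exact (h x.1 (f x) (g x)).trans ((congrArg₂ (· • ·) (toField_twist_eq Ω hg x y)
      (ofRing_order_eq coef p Ω hf x y)).trans (h y.1 (f y) (g y)).symm)
  | zero => simp only [Pi.zero_apply, map_zero]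
  | add f g _ _ hf hg => simp only [Pi.add_apply, map_add, hf, hg]
  | smul c f _ hf => simp only [Pi.smul_apply, map_smul, hf]

theorem ofModule_L_eq {U : Opens (projSpace k d)} {f : ∀ x : U, LStalk coef p x.1}
    (hf : f ∈ (L coef p).sec U) (x y : U) :
    fieldMatrix coef p Ω x.1 (TensorRing.ofModule k _ _ (f x)) =
      fieldMatrix coef p Ω y.1 (TensorRing.ofModule k _ _ (f y)) := by
  refine eq_of_locally_eq (fun x : U => fieldMatrix coef p Ω x.1 (TensorRing.ofModule k _ _ (f x)))
    (fun x => ?_) x y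
  obtain ⟨V, hx, i, hV⟩ := hf x
  exact ⟨V, hx, i, ofModule_LPre_eq coef p Ω hV⟩

theorem orderPart_le_constSections (U : Opens (projSpace k d)) :
    orderPart coef p U ≤ (constSections coef p Ω U).toSubmodule := by
  rintro _ ⟨f, hf, rfl⟩
  exact (mem_constSections coef p Ω).2 (ofRing_order_eq coef p Ω hf)

theorem LPart_le_constSections (U : Opens (projSpace k d)) :
    LPart coef p U ≤ (constSections coef p Ω U).toSubmodule := by
  rintro _ ⟨f, hf, rfl⟩
  exact (mem_constSections coef p Ω).2 (ofModule_L_eq coef p Ω hf)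

theorem powPre_le_constSections (l : ℕ) (U : Opens (projSpace k d)) :
    (powPre coef p l).sec U ≤ (constSections coef p Ω U).toSubmodule := by
  have hpow : LPart coef p U ^ l ≤ (constSections coef p Ω U).toSubmodule := by
    induction l with
    | zero =>
      rw [pow_zero, Submodule.one_le]
      exact one_mem (constSections coef p Ω U)
    | succ l ih =>
      rw [pow_succ]
      exact Submodule.mul_le.2 fun a ha b hb => mul_mem (S := Subalgebra k _) (ih ha)
        (LPart_le_constSections coef p Ω U hb)
  exact Submodule.mul_le.2 fun a ha b hb => mul_mem (S := Subalgebra k _)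
    (orderPart_le_constSections coef p Ω U ha) (hpow hb)

theorem fieldMatrix_H0_eq {l : ℕ} {f : ∀ x : (⊤ : Opens (projSpace k d)), TStalk coef p x.1}
    (hf : f ∈ H0 coef p l) (x y : (⊤ : Opens (projSpace k d))) :
    fieldMatrix coef p Ω x.1 (f x) = fieldMatrix coef p Ω y.1 (f y) := by
  refine eq_of_locally_eq (fun x : (⊤ : Opens (projSpace k d)) => fieldMatrix coef p Ω x.1 (f x))
    (fun x => ?_) x y
  obtain ⟨V, hx, i, hV⟩ := hf x
  exact ⟨V, hx, i, (mem_constSections coef p Ω).1 (powPre_le_constSections coef p Ω l V hV)⟩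

theorem powPre_mem_degPart {l : ℕ} {U : Opens (projSpace k d)} {f : ∀ x : U, TStalk coef p x.1}
    (hf : f ∈ (powPre coef p l).sec U) (x : U) :
    f x ∈ TensorRing.degPart k (OrderStalk coef p x.1) (LStalk coef p x.1) l := by
  let ev := Pi.evalAlgHom k (fun x : U => TStalk coef p x.1) x
  have h : ev f ∈ (orderPart coef p U * LPart coef p U ^ l).map ev.toLinearMap :=
    Submodule.mem_map_of_mem hf
  rw [Submodule.map_mul, Submodule.map_pow] at h
  have h1 : (orderPart coef p U).map ev.toLinearMap ≤
      LinearMap.range (TensorRing.ofRing k (OrderStalk coef p x.1) (LStalk coef p x.1)).toLinearMap := by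
    rintro _ ⟨_, ⟨g, -, rfl⟩, rfl⟩
    exact ⟨g x, rfl⟩
  have h2 : (LPart coef p U).map ev.toLinearMap ≤
      LinearMap.range (TensorRing.ofModule k (OrderStalk coef p x.1) (LStalk coef p x.1)) := by
    rintro _ ⟨_, ⟨g, -, rfl⟩, rfl⟩
    exact ⟨g x, rfl⟩
  have h3 := mul_le_mul' h1 (pow_le_pow_left' h2 l)
  exact h3 h

theorem H0_mem_degPart {l : ℕ} {f : ∀ x : (⊤ : Opens (projSpace k d)), TStalk coef p x.1}
    (hf : f ∈ H0 coef p l) (x : (⊤ : Opens (projSpace k d))) :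
    f x ∈ TensorRing.degPart k (OrderStalk coef p x.1) (LStalk coef p x.1) l := by
  obtain ⟨V, hx, i, hV⟩ := hf x
  exact powPre_mem_degPart coef p hV ⟨x.1, hx⟩

/-- The matrix over `Ω` of a family of germs at the generic point. -/
def genericMatrix :
    (∀ x : (⊤ : Opens (projSpace k d)), TStalk coef p x.1) →ₐ[k] Matrix (Idx p) (Idx p) Ω :=
  (fieldMatrix coef p Ω (genericPoint k d)).comp
    (Pi.evalAlgHom k (fun x : (⊤ : Opens (projSpace k d)) => TStalk coef p x.1)
      ⟨genericPoint k d, trivial⟩)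

/-- The matrix over `Ω` of a global section. -/
def sectionMatrix (l : ℕ) : H0 coef p l →ₗ[k] Matrix (Idx p) (Idx p) Ω :=
  (genericMatrix coef p Ω).toLinearMap ∘ₗ (H0 coef p l).subtype

theorem sectionMatrix_apply {l : ℕ} (f : H0 coef p l) :
    sectionMatrix coef p Ω l f = genericMatrix coef p Ω f.1 :=
  rfl

theorem sectionMatrix_eq {l : ℕ} (f : H0 coef p l) (x : (⊤ : Opens (projSpace k d))) :
    sectionMatrix coef p Ω l f = fieldMatrix coef p Ω x.1 (f.1 x) :=
  fieldMatrix_H0_eq coef p Ω f.2 ⟨genericPoint k d, trivial⟩ x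

theorem sectionMatrix_mul {a b c : ℕ} (f : H0 coef p a) (g : H0 coef p b) (h : H0 coef p c)
    (e : h.1 = f.1 * g.1) :
    sectionMatrix coef p Ω c h = sectionMatrix coef p Ω a f * sectionMatrix coef p Ω b g := by
  simp only [sectionMatrix_apply, e, map_mul]

theorem sectionMatrix_injective (hℓ : ∀ i, linearForm coef i ≠ 0) (l : ℕ) :
    Function.Injective (sectionMatrix coef p Ω l) := by
  rw [injective_iff_map_eq_zero]
  intro f hf
  refine Subtype.ext (funext fun x => ?_)
  exact eq_zero_of_fieldMatrix_eq_zero coef p Ω hℓ x.1 (H0_mem_degPart coef p f.2 x)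
    ((sectionMatrix_eq coef p Ω f x).symm.trans hf)

/-- The matrices over `Ω` whose entries are forms of degree `l`, divisible at the entry `(a, b)` by all
`ℓ_i` with `a i < b i`. -/
def formMatrices (l : ℕ) : Set (Matrix (Idx p) (Idx p) Ω) :=
  {M | ∀ a b, ∃ F : MvPolynomial (Fin (d + 1)) k,
    prodGen (linearForm coef) a b * F ∈ polyGrading k d l ∧
    M a b = algebraMap _ Ω (prodGen (linearForm coef) a b * F)}

theorem prodGen_mem (a b : Idx p) :
    prodGen (linearForm coef) a b ∈ polyGrading k d (numAbove a b) := by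
  refine MvPolynomial.IsHomogeneous.prod _ _ _ fun i _ => ?_
  unfold entryGen
  split_ifs
  · exact linearForm_mem coef i
  · exact MvPolynomial.isHomogeneous_one _ _

/-- The quotient of an entry by the required product of the `ℓ_i` is everywhere a fraction with
homogeneous denominator, so it is a polynomial; its degree can be read off at the generic point. -/
theorem sectionMatrix_mem (hd : 1 ≤ d) (hℓ : ∀ i, linearForm coef i ≠ 0) {l : ℕ} (f : H0 coef p l) :
    sectionMatrix coef p Ω l f ∈ formMatrices coef p Ω l := by
  intro a b
  have hinj := FaithfulSMul.algebraMap_injective (MvPolynomial (Fin (d + 1)) k) Ω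
  have hG := prodGen_ne_zero hℓ a b
  have hGΩ : algebraMap _ Ω (prodGen (linearForm coef) a b) ≠ 0 := (map_ne_zero_iff _ hinj).2 hG
  have hloc := fun x : projSpace k d => exists_fieldMatrix_eq coef p Ω hℓ x
    (H0_mem_degPart coef p f.2 ⟨x, trivial⟩) a b
  set z := sectionMatrix coef p Ω l f a b
  have hM : ∀ x : projSpace k d, fieldMatrix coef p Ω x (f.1 ⟨x, trivial⟩) a b = z := fun x =>
    congrFun (congrFun (sectionMatrix_eq coef p Ω f ⟨x, trivial⟩).symm a) b
  simp only [hM] at hloc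
  obtain ⟨F, hF⟩ := exists_eq_algebraMap hinj hd
    (z / algebraMap _ Ω (prodGen (linearForm coef) a b)) (fun x => by
      obtain ⟨e, u, v, -, hv, hvx, h⟩ := hloc x
      refine ⟨u, v, ⟨_, hv⟩, hvx, ?_⟩
      rw [div_mul_eq_mul_div, h, map_mul, mul_div_cancel_left₀ _ hGΩ])
  have hz : z = algebraMap _ Ω (prodGen (linearForm coef) a b * F) := by
    rw [map_mul, ← hF, mul_div_cancel₀ _ hGΩ]
  refine ⟨F, ?_, hz⟩
  obtain ⟨e, u, v, hu, hv, hvx, h⟩ := hloc (genericPoint k d)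
  refine mem_of_mul_mem hv (ne_of_mem_of_not_mem (zero_mem _) hvx).symm ?_
  rw [hz, ← map_mul] at h
  rw [hinj h]
  have := SetLike.mul_mem_graded (prodGen_mem coef p a b) hu
  rwa [← add_assoc, add_comm (numAbove a b)] at this

end Sections

/-! ### Construction of global sections -/

section Construction

variable {k : Type u} [Field k] {d n : ℕ} (coef : Fin n → Fin (d + 1) → k) (p : Fin n → ℕ)
  (Ω : Type u) [Field Ω] [Algebra k Ω] [Algebra (MvPolynomial (Fin (d + 1)) k) Ω]
  [IsScalarTower k (MvPolynomial (Fin (d + 1)) k) Ω] [FaithfulSMul (MvPolynomial (Fin (d + 1)) k) Ω]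

/-- The matrices over `Ω` of sections over `U` of the presheaf of finite sums of tensors of degree `l`,
taken before sheafification. -/
def matricesOn (U : Opens (projSpace k d)) (l : ℕ) : Submodule k (Matrix (Idx p) (Idx p) Ω) where
  carrier := {M | ∃ f ∈ (powPre coef p l).sec U, ∀ x : U, fieldMatrix coef p Ω x.1 (f x) = M}
  zero_mem' := ⟨0, zero_mem _, fun x => map_zero _⟩
  add_mem' := by
    rintro M N ⟨f, hf, h⟩ ⟨g, hg, h'⟩
    exact ⟨f + g, add_mem hf hg, fun x => by rw [Pi.add_apply, map_add, h, h']⟩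
  smul_mem' := by
    rintro c M ⟨f, hf, h⟩
    exact ⟨c • f, Submodule.smul_mem _ c hf, fun x => by rw [Pi.smul_apply, map_smul, h]⟩

variable {U : Opens (projSpace k d)}

theorem matricesOn_mul (a b : ℕ) :
    matricesOn coef p Ω U a * matricesOn coef p Ω U b ≤ matricesOn coef p Ω U (a + b) := by
  rw [Submodule.mul_le]
  rintro M ⟨f, hf, h⟩ N ⟨g, hg, h'⟩
  exact ⟨f * g, powPre_mul coef p a b (Submodule.mul_mem_mul hf hg), fun x => by
    rw [Pi.mul_apply, map_mul, h, h']⟩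

theorem ofRing_mem_powPre {f : ∀ x : U, OrderStalk coef p x.1} (hf : f ∈ (order coef p).sec U) :
    (fun x : U => TensorRing.ofRing k (OrderStalk coef p x.1) (LStalk coef p x.1) (f x)) ∈
      (powPre coef p 0).sec U := by
  change _ ∈ orderPart coef p U * LPart coef p U ^ 0
  rw [pow_zero, mul_one]
  exact ⟨f, hf, rfl⟩

theorem ofModule_mem_powPre {f : ∀ x : U, LStalk coef p x.1} (hf : f ∈ (L coef p).sec U) :
    (fun x : U => TensorRing.ofModule k (OrderStalk coef p x.1) (LStalk coef p x.1) (f x)) ∈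
      (powPre coef p 1).sec U := by
  change _ ∈ orderPart coef p U * LPart coef p U ^ 1
  rw [pow_one]
  have h1 : (1 : ∀ x : U, TStalk coef p x.1) ∈ orderPart coef p U :=
    ⟨1, order_one coef p U, funext fun x =>
      map_one (TensorRing.ofRing k (OrderStalk coef p x.1) (LStalk coef p x.1))⟩
  rw [← one_mul (fun x : U => TensorRing.ofModule k _ _ (f x))]
  exact Submodule.mul_mem_mul h1 ⟨f, hf, rfl⟩

theorem one_le_matricesOn_zero : 1 ≤ matricesOn coef p Ω U 0 := by
  rw [Submodule.one_le]
  exact ⟨_, ofRing_mem_powPre coef p (order_one coef p U), fun x =>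
    (congrArg _ (map_one (TensorRing.ofRing k _ _))).trans (map_one _)⟩

theorem twist_linearGerm {m : MvPolynomial (Fin (d + 1)) k} (hm : m ∈ polyGrading k d 1) :
    twist.pred fun x : U => linearGerm hm x.1 :=
  PrelocalPredicate.sheafifyOf (P := twistPre) ⟨0, ⟨m, hm⟩, ⟨1, SetLike.GradedOne.one_mem⟩,
    fun _ => one_mem _, fun _ => (Localization.mk_one_eq_algebraMap m).symm⟩

theorem linearL_mem (m : MvPolynomial (Fin (d + 1)) k) (hm : m ∈ polyGrading k d 1) :
    (fun x : U => linearL coef p hm x.1) ∈ (L coef p).sec U :=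
  SubPresheaf.mem_sheafify_of_mem _
    (Submodule.subset_span ⟨1, _, order_one coef p U, twist_linearGerm hm, rfl⟩)

theorem fieldMatrix_linearL {m : MvPolynomial (Fin (d + 1)) k} (hm : m ∈ polyGrading k d 1)
    (x : projSpace k d) :
    fieldMatrix coef p Ω x (TensorRing.ofModule k _ _ (linearL coef p hm x)) =
      algebraMap (MvPolynomial (Fin (d + 1)) k) (Matrix (Idx p) (Idx p) Ω) m := by
  rw [linearL, fieldMatrix_ofModule_tmul, map_one, map_one, Algebra.algebraMap_eq_smul_one,
    ← algebraMap_smul Ω m]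
  congr 1
  exact toField_algebraMap Ω x m

/-- Forms of degree `l` are sections of `L^{⊗ l}`: they are sums of products of linear forms, which are
sections of `L`. -/
theorem algebraMap_mem_matricesOn (l : ℕ) {F : MvPolynomial (Fin (d + 1)) k}
    (hF : F ∈ polyGrading k d l) : algebraMap _ _ F ∈ matricesOn coef p Ω U l := by
  let ψ : MvPolynomial (Fin (d + 1)) k →ₐ[k] Matrix (Idx p) (Idx p) Ω := IsScalarTower.toAlgHom k _ _
  have h1 : (polyGrading k d 1).map ψ.toLinearMap ≤ matricesOn coef p Ω U 1 := by
    rintro _ ⟨m, hm, rfl⟩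
    exact ⟨_, ofModule_mem_powPre coef p (linearL_mem coef p m hm), fun x =>
      fieldMatrix_linearL coef p Ω hm x.1⟩
  have hpow : ∀ r, matricesOn coef p Ω U 1 ^ r ≤ matricesOn coef p Ω U r := by
    intro r
    induction r with
    | zero => exact one_le_matricesOn_zero coef p Ω
    | succ r ih => exact (mul_le_mul' ih le_rfl).trans (matricesOn_mul coef p Ω r 1)
  have h2 : ψ F ∈ (polyGrading k d l).map ψ.toLinearMap := Submodule.mem_map_of_mem hF
  rw [polyGrading, ← MvPolynomial.homogeneousSubmodule_one_pow, Submodule.map_pow] at h2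
  exact hpow l (pow_le_pow_left' h1 l h2)

variable {p} in
/-- The product of the matrix units `(a i, b i)`, multiplied by `ℓ_i / T_j` above the diagonal. -/
def unitGerm (a b : Idx p) (j : Fin (d + 1)) (x : projSpace k d)
    (hj : (MvPolynomial.X j : MvPolynomial (Fin (d + 1)) k) ∉ primeAt x) (i : Fin n) :
    FactorStalk coef p i x :=
  ⟨Matrix.single (a i) (b i) (entryGen (formGerm coef i j x hj) (a i) (b i)), fun a' b' h => by
    rw [Matrix.single_apply]
    split_ifs with hab
    · obtain ⟨rfl, rfl⟩ := hab
      rw [entryGen, if_pos h, idealStalk_eq_span coef i j x hj]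
      exact Ideal.mem_span_singleton_self _
    · exact zero_mem _⟩

theorem unitGerm_mem_order (a b : Idx p) (j : Fin (d + 1))
    (hU : ∀ x : U, (MvPolynomial.X j : MvPolynomial (Fin (d + 1)) k) ∉ primeAt x.1) :
    (fun x : U => OrderStalk.tprod (unitGerm coef a b j x.1 (hU x))) ∈ (order coef p).sec U := by
  refine SubPresheaf.mem_sheafify_of_mem _ (Submodule.subset_span
    ⟨fun i x => unitGerm coef a b j x.1 (hU x) i, fun i a' b' => ?_, rfl⟩)
  by_cases h : a i = a' ∧ b i = b'
  · obtain ⟨rfl, rfl⟩ := h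
    have e : (fun x : U => (unitGerm coef a b j x.1 (hU x) i).1 (a i) (b i)) =
        fun x : U => entryGen (formGerm coef i j x.1 (hU x)) (a i) (b i) :=
      funext fun x => Matrix.single_apply_same _ _ _
    rw [e]
    by_cases hab : a i < b i
    · simp only [entryGen, if_pos hab]
      exact PrelocalPredicate.sheafifyOf
        (P := ProjectiveSpectrum.StructureSheaf.isFractionPrelocal (polyGrading k d))
        ⟨1, ⟨_, linearForm_mem coef i⟩, ⟨_, X_mem k j⟩, hU, fun x => rfl⟩
    · simp only [entryGen, if_neg hab]
      exact (regular U).one_mem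
  · have e : (fun x : U => (unitGerm coef a b j x.1 (hU x) i).1 a' b') = 0 :=
      funext fun x => Matrix.single_apply_of_ne _ _ _ _ _ h
    rw [e]
    exact (regular U).zero_mem

theorem fieldMatrix_unitGerm (a b : Idx p) (j : Fin (d + 1)) (x : projSpace k d)
    (hj : (MvPolynomial.X j : MvPolynomial (Fin (d + 1)) k) ∉ primeAt x) :
    fieldMatrix coef p Ω x (TensorRing.ofRing k _ _ (OrderStalk.tprod (unitGerm coef a b j x hj))) =
      Matrix.single a b (algebraMap _ Ω (prodGen (linearForm coef) a b) /
        algebraMap (MvPolynomial (Fin (d + 1)) k) Ω (MvPolynomial.X j) ^ numAbove a b) := by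
  ext a' b'
  have hX : algebraMap (MvPolynomial (Fin (d + 1)) k) Ω (MvPolynomial.X j) ≠ 0 :=
    (map_ne_zero_iff _ (FaithfulSMul.algebraMap_injective (MvPolynomial (Fin (d + 1)) k) Ω)).2
      (MvPolynomial.X_ne_zero j)
  let f := (toField Ω x).toRingHom.comp (algebraMap (OStalk x) (polyLoc x))
  have hf : ∀ i, f (formGerm coef i j x hj) *
      algebraMap (MvPolynomial (Fin (d + 1)) k) Ω (MvPolynomial.X j) =
        algebraMap (MvPolynomial (Fin (d + 1)) k) Ω (linearForm coef i) := fun i =>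
    toField_mk Ω x _ _ hj
  have hentry : ∀ i, f ((unitGerm coef a b j x hj i).1 (a' i) (b' i)) =
      if a i = a' i ∧ b i = b' i then entryGen (f (formGerm coef i j x hj)) (a i) (b i) else 0 := by
    intro i
    change f (Matrix.single (a i) (b i) _ (a' i) (b' i)) = _
    rw [Matrix.single_apply, apply_ite f, map_entryGen, map_zero]
  rw [fieldMatrix_tprod]
  refine (Finset.prod_congr rfl fun i _ => hentry i).trans ?_
  rw [Fintype.prod_ite_zero, Matrix.single_apply]
  simp only [forall_and, ← funext_iff]
  refine if_congr Iff.rfl ?_ rfl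
  change prodGen _ a b = _
  rw [eq_div_iff (pow_ne_zero _ hX), ← prodGen_mul_const, map_prodGen]
  simp only [hf]

/-- All matrices of forms with the right divisibility come from sections of the presheaf over the set
where `T_j` does not vanish. -/
theorem formMatrices_subset_matricesOn (hℓ : ∀ i, linearForm coef i ≠ 0) {j : Fin (d + 1)}
    (hU : ∀ x : U, (MvPolynomial.X j : MvPolynomial (Fin (d + 1)) k) ∉ primeAt x.1) {l : ℕ}
    {M : Matrix (Idx p) (Idx p) Ω} (hM : M ∈ formMatrices coef p Ω l) :
    M ∈ matricesOn coef p Ω U l := by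
  have hX : algebraMap (MvPolynomial (Fin (d + 1)) k) Ω (MvPolynomial.X j) ≠ 0 :=
    (map_ne_zero_iff _ (FaithfulSMul.algebraMap_injective (MvPolynomial (Fin (d + 1)) k) Ω)).2
      (MvPolynomial.X_ne_zero j)
  rw [Matrix.matrix_eq_sum_single M]
  refine sum_mem fun a _ => sum_mem fun b _ => ?_
  obtain ⟨F, hF, hab⟩ := hM a b
  have hG := prodGen_mem coef p a b
  rw [hab]
  rcases eq_zero_or_exists_mem hG (prodGen_ne_zero hℓ a b) hF with rfl | ⟨r, rfl, hFr⟩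
  · rw [mul_zero, map_zero, Matrix.single_zero]
    exact zero_mem _
  · have h0 : Matrix.single a b (algebraMap _ Ω (prodGen (linearForm coef) a b) /
        algebraMap (MvPolynomial (Fin (d + 1)) k) Ω (MvPolynomial.X j) ^ numAbove a b) ∈
        matricesOn coef p Ω U 0 :=
      ⟨_, ofRing_mem_powPre coef p (unitGerm_mem_order coef p a b j hU), fun x =>
        fieldMatrix_unitGerm coef p Ω a b j x.1 (hU x)⟩
    have hXF : MvPolynomial.X j ^ numAbove a b * F ∈ polyGrading k d (numAbove a b + r) := by
      refine SetLike.mul_mem_graded ?_ hFr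
      have := (MvPolynomial.isHomogeneous_X k j).pow (numAbove a b)
      rwa [one_mul] at this
    have h := matricesOn_mul coef p Ω _ _ (Submodule.mul_mem_mul h0
      (algebraMap_mem_matricesOn coef p Ω _ hXF))
    rw [zero_add, ← Algebra.commutes, ← Algebra.smul_def, ← algebraMap_smul Ω, Matrix.smul_single,
      smul_eq_mul] at h
    have e : algebraMap _ Ω (MvPolynomial.X j ^ numAbove a b * F) *
        (algebraMap _ Ω (prodGen (linearForm coef) a b) /
          algebraMap (MvPolynomial (Fin (d + 1)) k) Ω (MvPolynomial.X j) ^ numAbove a b) =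
        algebraMap _ Ω (prodGen (linearForm coef) a b * F) := by
      rw [map_mul, map_mul, map_pow]
      field_simp
    exact e ▸ h

/-- The global sections of `L^{⊗ l}` are the matrices of forms of degree `l` with the divisibility
imposed by `Λ`. -/
theorem range_sectionMatrix (hd : 1 ≤ d) (hℓ : ∀ i, linearForm coef i ≠ 0) (l : ℕ) :
    Set.range (sectionMatrix coef p Ω l) = formMatrices coef p Ω l := by
  refine Set.Subset.antisymm ?_ fun M hM => ?_
  · rintro _ ⟨f, rfl⟩
    exact sectionMatrix_mem coef p Ω hd hℓ f
  -- local sections with matrix `M` glue, since a germ of degree `l` is determined by its matrix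
  choose j hj using fun x : projSpace k d => exists_X_notMem x
  let V : projSpace k d → Opens (projSpace k d) := fun x =>
    ProjectiveSpectrum.basicOpen (polyGrading k d) (MvPolynomial.X (j x))
  choose g hg hgM using fun x : projSpace k d => formMatrices_subset_matricesOn coef p Ω hℓ
    (U := V x) (j := j x) (fun y => y.2) hM
  have hmem : (fun x : (⊤ : Opens (projSpace k d)) => g x.1 ⟨x.1, hj x.1⟩) ∈ H0 coef p l := by
    intro x
    refine ⟨V x.1, hj x.1, homOfLE le_top, ?_⟩
    have e : (fun y : V x.1 => g y.1 ⟨y.1, hj y.1⟩) = g x.1 := by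
      funext y
      refine sub_eq_zero.1 (eq_zero_of_fieldMatrix_eq_zero coef p Ω hℓ y.1 (l := l)
        (sub_mem (powPre_mem_degPart coef p (hg y.1) ⟨y.1, hj y.1⟩)
          (powPre_mem_degPart coef p (hg x.1) y)) ?_)
      exact (map_sub _ _ _).trans (sub_eq_zero.2 ((hgM y.1 ⟨y.1, hj y.1⟩).trans (hgM x.1 y).symm))
    exact e ▸ hg x.1
  exact ⟨⟨_, hmem⟩, (sectionMatrix_eq coef p Ω ⟨_, hmem⟩ ⟨genericPoint k d, trivial⟩).trans
    (hgM (genericPoint k d) ⟨genericPoint k d, hj _⟩)⟩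

end Construction

/-! ### The weight group and the ring `R` -/

section Weights

variable {n : ℕ} (p : Fin n → ℕ)

/-- Equality in the weight group: the relations allow `p_i` copies of `x_i` to be traded for one `c`. -/
theorem mk_eq_mk_iff {v v' : Fin n → ℤ} {u u' : ℤ} :
    ((QuotientAddGroup.mk (v, u) : WeightGroup p) = QuotientAddGroup.mk (v', u')) ↔
      ∃ q : Fin n → ℤ, (∀ i, v' i = v i + p i * q i) ∧ u' + ∑ i, q i = u := by
  rw [QuotientAddGroup.eq]
  constructor
  · have key : ∀ z ∈ AddSubgroup.closure
        (Set.range fun i : Fin n => ((Pi.single i (p i : ℤ), -1) : (Fin n → ℤ) × ℤ)),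
        ∃ q : Fin n → ℤ, (∀ i, z.1 i = p i * q i) ∧ z.2 = - ∑ i, q i := by
      intro z hz
      induction hz using AddSubgroup.closure_induction with
      | mem z hz =>
        obtain ⟨i, rfl⟩ := hz
        refine ⟨Pi.single i 1, fun j => ?_, by simp⟩
        by_cases h : j = i
        · subst h; simp
        · simp [h]
      | zero => exact ⟨0, by simp, by simp⟩
      | add z w _ _ hz hw =>
        obtain ⟨q, h1, h2⟩ := hz
        obtain ⟨r, h3, h4⟩ := hw
        refine ⟨q + r, fun i => ?_, ?_⟩
        · simp only [Prod.fst_add, Pi.add_apply, h1, h3, mul_add]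
        · simp only [Prod.snd_add, h2, h4, Pi.add_apply, Finset.sum_add_distrib, neg_add]
      | neg z _ hz =>
        obtain ⟨q, h1, h2⟩ := hz
        refine ⟨-q, fun i => ?_, ?_⟩
        · simp only [Prod.fst_neg, Pi.neg_apply, h1, mul_neg]
        · simp only [Prod.snd_neg, h2, Pi.neg_apply, Finset.sum_neg_distrib]
    intro h
    obtain ⟨q, h1, h2⟩ := key _ h
    refine ⟨q, fun i => ?_, ?_⟩
    · have := h1 i
      simp only [Prod.fst_add, Prod.fst_neg, Pi.add_apply, Pi.neg_apply] at this
      linarith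
    · simp only [Prod.snd_add, Prod.snd_neg] at h2
      linarith
  · rintro ⟨q, h1, h2⟩
    have e : -(v, u) + (v', u') =
        ∑ i, q i • ((Pi.single i (p i : ℤ), -1) : (Fin n → ℤ) × ℤ) := by
      refine Prod.ext (funext fun j => ?_) ?_
      · simp only [Prod.fst_add, Prod.fst_neg, Pi.add_apply, Pi.neg_apply, h1, Prod.fst_sum,
          Prod.smul_fst, Finset.sum_apply, Pi.smul_apply, smul_eq_mul]
        rw [Finset.sum_eq_single j (fun i _ hi => by simp [Pi.single_eq_of_ne hi.symm])
          (fun h => (h (Finset.mem_univ j)).elim), Pi.single_eq_same]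
        ring
      · simp only [Prod.snd_add, Prod.snd_neg, ← h2, Prod.snd_sum, Prod.smul_snd, smul_eq_mul,
          mul_neg, mul_one, Finset.sum_neg_distrib]
        ring
    rw [e]
    exact sum_mem fun i _ => AddSubgroup.zsmul_mem _
      (AddSubgroup.subset_closure (Set.mem_range_self i)) _

theorem sum_xvec_add (v : Fin n → ℤ) (u : ℤ) :
    ∑ i, v i • xvec p i + u • cvec p = QuotientAddGroup.mk (v, u) := by
  have e : (v, u) = ∑ i, v i • ((Pi.single i 1, 0) : (Fin n → ℤ) × ℤ) + u • (0, 1) := by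
    refine Prod.ext (funext fun j => ?_) ?_
    · simp [Prod.fst_sum, Finset.sum_apply, Pi.single_apply]
    · simp [Prod.snd_sum]
  let π : (Fin n → ℤ) × ℤ →+ WeightGroup p := QuotientAddGroup.mk' _
  have h : π (v, u) = ∑ i, v i • π (Pi.single i 1, 0) + u • π (0, 1) := by
    rw [e, map_add, map_sum]
    simp only [map_zsmul]
  exact h.symm

theorem zsmul_cvec_injective (hp : ∀ i, 1 ≤ p i) :
    Function.Injective fun m : ℤ => m • cvec p := by
  intro m m' h
  have e : ∀ m : ℤ, m • cvec p = QuotientAddGroup.mk (0, m) := fun m => by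
    rw [← sum_xvec_add]
    simp
  simp only [e] at h
  obtain ⟨q, h1, h2⟩ := (mk_eq_mk_iff p).1 h
  have hq : ∀ i, q i = 0 := fun i => by
    have h3 := h1 i
    have := hp i
    simp only [Pi.zero_apply, zero_add] at h3
    exact (mul_eq_zero.1 h3.symm).resolve_left (by omega)
  simp only [hq, Finset.sum_const_zero, add_zero] at h2
  exact h2.symm

/-- The element `m c` of `ℤc`. -/
def degIdx (m : ℤ) : AddSubgroup.zmultiples (cvec p) :=
  ⟨m • cvec p, AddSubgroup.zsmul_mem_zmultiples _ _⟩

theorem degIdx_injective (hp : ∀ i, 1 ≤ p i) : Function.Injective (degIdx p) := fun _ _ h =>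
  zsmul_cvec_injective p hp (congrArg Subtype.val h)

theorem degIdx_add (m m' : ℤ) : degIdx p m + degIdx p m' = degIdx p (m + m') :=
  Subtype.ext (add_zsmul _ _ _).symm

theorem degIdx_zero : degIdx p 0 = 0 := Subtype.ext (zero_zsmul _)

theorem degIdx_surjective : Function.Surjective (degIdx p) := by
  rintro ⟨_, m, rfl⟩
  exact ⟨m, rfl⟩

/-- The weight of a monomial, compared with the degree of the entry `(a, b)` of `R^{[ℤc]}` in
degree `m`. -/
theorem weight_eq_iff {d : ℕ} (s : Fin (d + 1) ⊕ Fin n →₀ ℕ) (a b : Idx p) (m : ℤ) :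
    Finsupp.weight (weight p) s = stdRep p a - stdRep p b + m • cvec p ↔
      ∃ q : Fin n → ℤ, (∀ i, (s (Sum.inr i) : ℤ) = (a i : ℕ) - (b i : ℕ) + p i * q i) ∧
        (∑ j, (s (Sum.inl j) : ℤ)) + ∑ i, q i = m := by
  have h1 : Finsupp.weight (weight p) s = QuotientAddGroup.mk
      ((fun i => (s (Sum.inr i) : ℤ)), ∑ j, (s (Sum.inl j) : ℤ)) := by
    rw [← sum_xvec_add, Finsupp.weight_apply, Finsupp.sum_fintype _ _ (fun i => zero_smul ℕ (weight p i)),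
      Fintype.sum_sum_type, add_comm, ← Nat.cast_sum]
    simp only [natCast_zsmul]
    exact congrArg _ Finset.sum_smul.symm
  have h2 : stdRep p a - stdRep p b + m • cvec p = QuotientAddGroup.mk
      ((fun i => ((a i : ℕ) : ℤ) - (b i : ℕ)), m) := by
    rw [← sum_xvec_add]
    simp only [stdRep, sub_smul, Finset.sum_sub_distrib, natCast_zsmul]
  rw [h1, h2, eq_comm, mk_eq_mk_iff]

/-- The representative of `a - b` modulo `p` in `[0, p)`. -/
def modSub {p : ℕ} (a b : Fin p) : ℕ := if a < b then p + a - b else a - b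

theorem add_modSub {p : ℕ} (a b : Fin p) :
    (b : ℕ) + modSub a b = a + p * (if a < b then 1 else 0) := by
  have := b.2
  unfold modSub
  split_ifs with h
  · omega
  · rw [Fin.lt_def] at h
    omega

theorem sum_modSub_add (a b : Idx p) (r : ℕ) :
    ∑ i, modSub (a i) (b i) • xvec p i + (r : ℤ) • cvec p =
      stdRep p a - stdRep p b + ((numAbove a b + r : ℕ) : ℤ) • cvec p := by
  have h1 := sum_xvec_add p (fun i => (modSub (a i) (b i) : ℤ)) r
  have h2 := sum_xvec_add p (fun i => ((a i : ℕ) : ℤ) - (b i : ℕ)) (numAbove a b + r : ℕ)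
  simp only [natCast_zsmul, sub_smul, Finset.sum_sub_distrib] at h1 h2
  simp only [natCast_zsmul]
  refine h1.trans (((mk_eq_mk_iff p).2 ⟨fun i => -(if a i < b i then 1 else 0), fun i => ?_, ?_⟩).trans
    h2.symm)
  · have h := add_modSub (a i) (b i)
    zify at h
    linarith
  · rw [Finset.sum_neg_distrib, numAbove]
    push_cast
    ring

/-- A natural number congruent to `a - b` modulo `p` exceeds `modSub a b` by a multiple of `p`. -/
theorem exists_eq_modSub_add {p : ℕ} (a b : Fin p) (s : ℕ) (q : ℤ)
    (h : (s : ℤ) = (a : ℕ) - (b : ℕ) + p * q) :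
    ∃ e : ℕ, q = e + (if a < b then 1 else 0) ∧ s = modSub a b + p * e := by
  have ha := a.2
  have hb := b.2
  have hp : (0 : ℤ) < p := by omega
  have h1 : (if a < b then 1 else 0 : ℤ) ≤ q := by
    split_ifs with hab
    · rw [Fin.lt_def] at hab
      have : (0 : ℤ) < p * q := by omega
      exact (pos_iff_pos_of_mul_pos this).1 hp
    · by_contra hq
      have : (p : ℤ) * q ≤ p * (-1) := mul_le_mul_of_nonneg_left (by omega) hp.le
      omega
  obtain ⟨e, he⟩ := Int.le.dest h1
  refine ⟨e, by rw [← he, add_comm], ?_⟩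
  have h2 := add_modSub a b
  zify at h2 ⊢
  rw [← he, mul_add] at h
  linarith

end Weights

/-! ### Homogeneous elements of `R` as matrices of forms -/

section GLRingMatrix

variable {k : Type u} [Field k] {d n : ℕ} (coef : Fin n → Fin (d + 1) → k) (p : Fin n → ℕ)

/-- The inclusion of the polynomial ring `S` in `R`. -/
def polyToGL : MvPolynomial (Fin (d + 1)) k →ₐ[k] GLRing p coef :=
  (Ideal.Quotient.mkₐ k (relIdeal p coef)).comp (MvPolynomial.rename Sum.inl)

/-- The image of `X_i` in `R`. -/
def glX (i : Fin n) : GLRing p coef :=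
  Ideal.Quotient.mkₐ k (relIdeal p coef) (MvPolynomial.X (Sum.inr i))

theorem glX_pow (i : Fin n) : glX coef p i ^ p i = polyToGL coef p (linearForm coef i) := by
  rw [glX, ← map_pow]
  exact Ideal.Quotient.eq.2 (Ideal.subset_span ⟨i, rfl⟩)

theorem prodGen_eq_prod_pow {M : Type*} [CommMonoid M] (γ : Fin n → M) (a b : Idx p) :
    prodGen γ a b = ∏ i, γ i ^ (if a i < b i then 1 else 0) := by
  refine Finset.prod_congr rfl fun i _ => ?_
  unfold entryGen
  split_ifs <;> simp

/-- A monomial of `R` of the degree of the entry `(a, b)` of `R^{[ℤc]}`: reduce the exponents of the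
`X_i` modulo `p_i`, using `X_i ^ p_i = ℓ_i`. -/
theorem exists_monomial_eq (s : Fin (d + 1) ⊕ Fin n →₀ ℕ) (a b : Idx p) (m : ℤ)
    (hs : Finsupp.weight (weight p) s = stdRep p a - stdRep p b + m • cvec p) :
    ∃ (l : ℕ) (F : MvPolynomial (Fin (d + 1)) k), (l : ℤ) = m ∧
      prodGen (linearForm coef) a b * F ∈ polyGrading k d l ∧
      Ideal.Quotient.mkₐ k (relIdeal p coef) (MvPolynomial.monomial s 1) =
        (∏ i, glX coef p i ^ modSub (a i) (b i)) * polyToGL coef p F := by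
  obtain ⟨q, h1, h2⟩ := (weight_eq_iff p s a b m).1 hs
  choose e he hse using fun i => exists_eq_modSub_add (a i) (b i) _ (q i) (h1 i)
  refine ⟨numAbove a b + (∑ j, s (Sum.inl j) + ∑ i, e i),
    (∏ j, MvPolynomial.X j ^ s (Sum.inl j)) * ∏ i, linearForm coef i ^ e i, ?_, ?_, ?_⟩
  · rw [← h2, numAbove]
    simp only [he, Finset.sum_add_distrib]
    push_cast
    ring
  · refine SetLike.mul_mem_graded (prodGen_mem coef p a b) (SetLike.mul_mem_graded ?_ ?_)
    · refine MvPolynomial.IsHomogeneous.prod _ _ _ fun j _ => ?_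
      have := (MvPolynomial.isHomogeneous_X k j).pow (s (Sum.inl j))
      rwa [one_mul] at this
    · refine MvPolynomial.IsHomogeneous.prod _ _ _ fun i _ => ?_
      have := MvPolynomial.IsHomogeneous.pow (linearForm_mem coef i) (e i)
      rwa [one_mul] at this
  · rw [MvPolynomial.monomial_eq, Finsupp.prod_fintype _ _ (fun _ => pow_zero _),
      Fintype.prod_sum_type, map_one, one_mul, map_mul, map_mul, map_prod, map_prod, map_prod,
      map_prod, mul_left_comm, ← Finset.prod_mul_distrib]
    congr 1
    · refine Finset.prod_congr rfl fun j _ => ?_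
      rw [map_pow, polyToGL, map_pow, AlgHom.comp_apply, MvPolynomial.rename_X]
    · refine Finset.prod_congr rfl fun i _ => ?_
      rw [map_pow, map_pow, ← glX_pow, ← pow_mul, ← pow_add, ← hse]
      rfl

/-- The shape of the elements of `R` of the degree of the entry `(a, b)` of `R^{[ℤc]}`. The degree of
`F` is `l - numAbove a b`; stating it for the product `prodGen * F` avoids the subtraction. -/
theorem exists_glGrading_eq (a b : Idx p) (l : ℕ) {N : GLRing p coef}
    (hN : N ∈ glGrading p coef (stdRep p a - stdRep p b + (l : ℤ) • cvec p)) :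
    ∃ F : MvPolynomial (Fin (d + 1)) k, prodGen (linearForm coef) a b * F ∈ polyGrading k d l ∧
      N = (∏ i, glX coef p i ^ modSub (a i) (b i)) * polyToGL coef p F := by
  obtain ⟨P, hP, rfl⟩ := hN
  let W : Submodule k (GLRing p coef) :=
    ((polyGrading k d l).comap (LinearMap.mulLeft k (prodGen (linearForm coef) a b))).map
      (LinearMap.mulLeft k (∏ i, glX coef p i ^ modSub (a i) (b i)) ∘ₗ (polyToGL coef p).toLinearMap)
  suffices h : Ideal.Quotient.mkₐ k (relIdeal p coef) P ∈ W by
    obtain ⟨F, hF, h⟩ := h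
    exact ⟨F, hF, h.symm⟩
  rw [P.as_sum, map_sum]
  refine sum_mem fun s hs => ?_
  obtain ⟨l', F, hl, hF, h⟩ := exists_monomial_eq coef p s a b l (hP (MvPolynomial.mem_support_iff.1 hs))
  obtain rfl : l' = l := by exact_mod_cast hl
  rw [← mul_one (P.coeff s), ← smul_eq_mul, ← MvPolynomial.smul_monomial, map_smul, h]
  exact W.smul_mem _ ⟨F, hF, rfl⟩

theorem eq_zero_of_neg (a b : Idx p) {m : ℤ} (hm : m < 0) {N : GLRing p coef}
    (hN : N ∈ glGrading p coef (stdRep p a - stdRep p b + m • cvec p)) : N = 0 := by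
  obtain ⟨P, hP, rfl⟩ := hN
  have h : P = 0 := by
    by_contra hP0
    obtain ⟨s, hs⟩ := MvPolynomial.ne_zero_iff.1 hP0
    obtain ⟨l, -, hl, -⟩ := exists_monomial_eq coef p s a b m (hP hs)
    omega
  rw [h, map_zero]

theorem rename_isWeightedHomogeneous {F : MvPolynomial (Fin (d + 1)) k} {r : ℕ}
    (hF : F ∈ polyGrading k d r) :
    (MvPolynomial.rename Sum.inl F).IsWeightedHomogeneous (weight (d := d) p) ((r : ℤ) • cvec p) := by
  intro s hs
  obtain ⟨t, rfl, ht⟩ := MvPolynomial.coeff_rename_ne_zero _ _ _ hs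
  have h1 := hF ht
  rw [Finsupp.weight_apply, Finsupp.sum_mapDomain_index (fun i => zero_smul ℕ (weight p i))
    (fun i u v => add_smul u v (weight p i))]
  rw [natCast_zsmul, ← h1, Finsupp.weight_apply, Finsupp.sum, Finsupp.sum]
  simp only [Pi.one_apply, smul_eq_mul, mul_one]
  exact Finset.sum_smul.symm

theorem mul_mem_glGrading (a b : Idx p) (l : ℕ) (hℓ : ∀ i, linearForm coef i ≠ 0)
    {F : MvPolynomial (Fin (d + 1)) k}
    (hF : prodGen (linearForm coef) a b * F ∈ polyGrading k d l) :
    (∏ i, glX coef p i ^ modSub (a i) (b i)) * polyToGL coef p F ∈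
      glGrading p coef (stdRep p a - stdRep p b + (l : ℤ) • cvec p) := by
  rcases eq_zero_or_exists_mem (prodGen_mem coef p a b) (prodGen_ne_zero hℓ a b) hF with
    rfl | ⟨r, rfl, hFr⟩
  · rw [map_zero, mul_zero]
    exact zero_mem _
  · refine ⟨(∏ i, MvPolynomial.X (Sum.inr i) ^ modSub (a i) (b i)) * MvPolynomial.rename Sum.inl F,
      ?_, ?_⟩
    · rw [← sum_modSub_add]
      exact (MvPolynomial.IsWeightedHomogeneous.prod _ _ _ fun i _ =>
        (MvPolynomial.isWeightedHomogeneous_X k (weight p) (Sum.inr i)).pow _).mul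
          (rename_isWeightedHomogeneous p hFr)
    · exact (map_mul (Ideal.Quotient.mkₐ k (relIdeal p coef)) _ _).trans
        (congrArg (· * _) ((map_prod (Ideal.Quotient.mkₐ k (relIdeal p coef)) _ _).trans
          (Finset.prod_congr rfl fun i _ => map_pow _ _ _)))

variable {Ω : Type u} [Field Ω] [Algebra (MvPolynomial (Fin (d + 1)) k) Ω] {y : Fin n → Ω}

variable {p} in
/-- The product of the `y_i ^ (a i)`. -/
def rootPow (y : Fin n → Ω) (a : Idx p) : Ω := ∏ i, y i ^ (a i : ℕ)

/-- The exponent `b i + modSub (a i) (b i)` is `a i`, plus `p_i` if `a i < b i`; the excess contributes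
the factors `y_i ^ p_i = ℓ_i` of `prodGen`. -/
theorem rootPow_mul (hy : ∀ i, y i ^ p i = algebraMap _ Ω (linearForm coef i)) (a b : Idx p) :
    rootPow y b * ∏ i, y i ^ modSub (a i) (b i) =
      rootPow y a * algebraMap _ Ω (prodGen (linearForm coef) a b) := by
  rw [rootPow, rootPow, ← Finset.prod_mul_distrib, prodGen_eq_prod_pow, map_prod,
    ← Finset.prod_mul_distrib]
  refine Finset.prod_congr rfl fun i _ => ?_
  rw [← pow_add, add_modSub, pow_add, pow_mul, hy, map_pow]

theorem rootPow_ne_zero (hy0 : ∀ i, y i ≠ 0) (a : Idx p) : rootPow y a ≠ 0 :=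
  Finset.prod_ne_zero_iff.2 fun i _ => pow_ne_zero _ (hy0 i)

variable [Algebra k Ω]

/-- The homomorphism `k[T, X] → Ω` extending the inclusion of `k[T]` that maps `X_i` to `y_i`. -/
def rootEval (y : Fin n → Ω) : MvPolynomial (Fin (d + 1) ⊕ Fin n) k →ₐ[k] Ω :=
  MvPolynomial.aeval
    (Sum.elim (fun j => algebraMap (MvPolynomial (Fin (d + 1)) k) Ω (MvPolynomial.X j)) y)

theorem rootEval_X_inr (y : Fin n → Ω) (i : Fin n) :
    rootEval (k := k) (d := d) y (MvPolynomial.X (Sum.inr i)) = y i :=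
  MvPolynomial.aeval_X _ _

variable [IsScalarTower k (MvPolynomial (Fin (d + 1)) k) Ω]

theorem rootEval_rename (y : Fin n → Ω) (F : MvPolynomial (Fin (d + 1)) k) :
    rootEval y (MvPolynomial.rename Sum.inl F) = algebraMap _ Ω F := by
  have h : (rootEval y).comp (MvPolynomial.rename Sum.inl) =
      IsScalarTower.toAlgHom k (MvPolynomial (Fin (d + 1)) k) Ω := by
    refine MvPolynomial.algHom_ext fun j => ?_
    rw [AlgHom.comp_apply, MvPolynomial.rename_X]
    exact MvPolynomial.aeval_X _ _
  exact DFunLike.congr_fun h F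

theorem relIdeal_le_ker (hy : ∀ i, y i ^ p i = algebraMap _ Ω (linearForm coef i)) :
    relIdeal p coef ≤ RingHom.ker (rootEval (k := k) (d := d) y) := by
  refine Ideal.span_le.2 ?_
  rintro _ ⟨i, rfl⟩
  exact (map_sub _ _ _).trans (sub_eq_zero.2 (by
    rw [map_pow, rootEval_X_inr, rootEval_rename, hy]))

/-- The homomorphism from `R` to a field containing `p_i`-th roots `y_i` of the `ℓ_i`. -/
def glToField (hy : ∀ i, y i ^ p i = algebraMap _ Ω (linearForm coef i)) : GLRing p coef →ₐ[k] Ω :=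
  Ideal.Quotient.liftₐ (relIdeal p coef) (rootEval y) fun _ ha => relIdeal_le_ker coef p hy ha

variable (hy : ∀ i, y i ^ p i = algebraMap _ Ω (linearForm coef i))

@[simp]
theorem glToField_glX (i : Fin n) : glToField coef p hy (glX coef p i) = y i :=
  rootEval_X_inr y i

@[simp]
theorem glToField_polyToGL (F : MvPolynomial (Fin (d + 1)) k) :
    glToField coef p hy (polyToGL coef p F) = algebraMap _ Ω F :=
  rootEval_rename y F

/-- The embedding of matrices over `R` in matrices over `Ω`, conjugated by the diagonal matrix of the
`∏ y_i ^ (a i)`, so that the images of homogeneous elements of `R^{[ℤc]}` are matrices of forms. -/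
def conjMatrix : Matrix (Idx p) (Idx p) (GLRing p coef) →ₗ[k] Matrix (Idx p) (Idx p) Ω where
  toFun N := Matrix.of fun a b => rootPow y b * glToField coef p hy (N a b) / rootPow y a
  map_add' M N := by
    ext a b
    simp only [Matrix.of_apply, Matrix.add_apply, map_add, mul_add, add_div]
  map_smul' c N := by
    ext a b
    simp only [Matrix.of_apply, Matrix.smul_apply, map_smul, RingHom.id_apply, mul_smul_comm,
      smul_div_assoc]

theorem conjMatrix_apply (N : Matrix (Idx p) (Idx p) (GLRing p coef)) (a b : Idx p) :
    conjMatrix coef p hy N a b = rootPow y b * glToField coef p hy (N a b) / rootPow y a :=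
  rfl

theorem conjMatrix_one (hy0 : ∀ i, y i ≠ 0) : conjMatrix coef p hy 1 = 1 := by
  ext a b
  rw [conjMatrix_apply]
  by_cases h : a = b
  · subst h
    rw [Matrix.one_apply_eq, Matrix.one_apply_eq, map_one, mul_one,
      div_self (rootPow_ne_zero p hy0 a)]
  · rw [Matrix.one_apply_ne h, Matrix.one_apply_ne h, map_zero, mul_zero, zero_div]

theorem conjMatrix_mul (hy0 : ∀ i, y i ≠ 0) (M N : Matrix (Idx p) (Idx p) (GLRing p coef)) :
    conjMatrix coef p hy (M * N) = conjMatrix coef p hy M * conjMatrix coef p hy N := by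
  ext a c
  simp only [conjMatrix_apply, Matrix.mul_apply, map_sum, map_mul, Finset.mul_sum, Finset.sum_div]
  refine Finset.sum_congr rfl fun b _ => ?_
  have := rootPow_ne_zero p hy0 b
  have := rootPow_ne_zero p hy0 a
  field_simp

theorem conjMatrix_entry (hy0 : ∀ i, y i ≠ 0) {N : Matrix (Idx p) (Idx p) (GLRing p coef)}
    {a b : Idx p} {F : MvPolynomial (Fin (d + 1)) k}
    (h : N a b = (∏ i, glX coef p i ^ modSub (a i) (b i)) * polyToGL coef p F) :
    conjMatrix coef p hy N a b = algebraMap _ Ω (prodGen (linearForm coef) a b * F) := by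
  rw [conjMatrix_apply, h, map_mul, map_prod, glToField_polyToGL, ← mul_assoc]
  simp only [map_pow, glToField_glX]
  rw [rootPow_mul coef p hy, map_mul, mul_assoc, mul_div_cancel_left₀ _ (rootPow_ne_zero p hy0 a)]

/-- The homogeneous part of `R^{[ℤc]}` of degree `m`. -/
abbrev glPiece (m : ℤ) : Submodule k (Matrix (Idx p) (Idx p) (GLRing p coef)) :=
  regradePiece (glGrading p coef) (AddSubgroup.zmultiples (cvec p)) (stdRep p) (degIdx p m)

theorem one_mem_glPiece : 1 ∈ glPiece coef p 0 := by
  rw [glPiece, degIdx_zero]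
  exact SetLike.GradedOne.one_mem (A := regradePiece (glGrading p coef)
    (AddSubgroup.zmultiples (cvec p)) (stdRep p))

theorem mul_mem_glPiece {m m' : ℤ} {M N : Matrix (Idx p) (Idx p) (GLRing p coef)}
    (hM : M ∈ glPiece coef p m) (hN : N ∈ glPiece coef p m') : M * N ∈ glPiece coef p (m + m') := by
  rw [glPiece, ← degIdx_add]
  exact SetLike.GradedMul.mul_mem (A := regradePiece (glGrading p coef)
    (AddSubgroup.zmultiples (cvec p)) (stdRep p)) hM hN

theorem glPiece_eq_bot {m : ℤ} (hm : m < 0) : glPiece coef p m = ⊥ :=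
  (Submodule.eq_bot_iff _).2 fun _ hN => Matrix.ext fun a b => eq_zero_of_neg coef p a b hm (hN a b)

/-- The homogeneous elements of `R^{[ℤc]}` of degree `l`, after conjugation, are the matrices of forms
of degree `l` with the same divisibility as for `Λ`. -/
theorem range_conjMatrix (hℓ : ∀ i, linearForm coef i ≠ 0) (hy0 : ∀ i, y i ≠ 0) (l : ℕ) :
    Set.range (conjMatrix coef p hy ∘ₗ (glPiece coef p l).subtype) = formMatrices coef p Ω l := by
  ext M
  constructor
  · rintro ⟨N, rfl⟩ a b
    obtain ⟨F, hF, h⟩ := exists_glGrading_eq coef p a b l (N.2 a b)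
    exact ⟨F, hF, conjMatrix_entry coef p hy hy0 h⟩
  · intro hM
    choose F hF h using hM
    refine ⟨⟨Matrix.of fun a b => (∏ i, glX coef p i ^ modSub (a i) (b i)) * polyToGL coef p (F a b),
      fun a b => mul_mem_glGrading coef p a b l hℓ (hF a b)⟩, Matrix.ext fun a b => ?_⟩
    exact (conjMatrix_entry coef p hy hy0 rfl).trans (h a b).symm

variable [FaithfulSMul (MvPolynomial (Fin (d + 1)) k) Ω]

theorem conjMatrix_injective (hℓ : ∀ i, linearForm coef i ≠ 0) (hy0 : ∀ i, y i ≠ 0) (l : ℕ) :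
    Function.Injective (conjMatrix coef p hy ∘ₗ (glPiece coef p l).subtype) := by
  rw [injective_iff_map_eq_zero]
  rintro ⟨N, hN⟩ h0
  refine Subtype.ext (Matrix.ext fun a b => ?_)
  obtain ⟨F, hF, h⟩ := exists_glGrading_eq coef p a b l (hN a b)
  have h1 : algebraMap _ Ω (prodGen (linearForm coef) a b * F) = 0 :=
    (conjMatrix_entry coef p hy hy0 h).symm.trans (congrFun (congrFun h0 a) b)
  rw [FaithfulSMul.algebraMap_eq_zero_iff] at h1
  change N a b = 0
  rw [h, (mul_eq_zero.1 h1).resolve_left (prodGen_ne_zero hℓ a b), map_zero, mul_zero]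

end GLRingMatrix

/-! ### Comparison of the two graded rings -/

section Comparison

theorem exists_linearEquiv_of_range_eq {k V W M : Type*} [Field k] [AddCommGroup V] [Module k V]
    [AddCommGroup W] [Module k W] [AddCommGroup M] [Module k M] {f : V →ₗ[k] M} {g : W →ₗ[k] M}
    (hf : Function.Injective f) (hg : Function.Injective g) (h : Set.range f = Set.range g) :
    ∃ e : V ≃ₗ[k] W, ∀ v, g (e v) = f v := by
  have h' : LinearMap.range f = LinearMap.range g := SetLike.coe_injective h
  refine ⟨(LinearEquiv.ofInjective f hf).trans ((LinearEquiv.ofEq _ _ h').trans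
    (LinearEquiv.ofInjective g hg).symm), fun v => ?_⟩
  exact congrArg Subtype.val (LinearEquiv.apply_symm_apply (LinearEquiv.ofInjective g hg)
    (LinearEquiv.ofEq _ _ h' (LinearEquiv.ofInjective f hf v)))

theorem lof_eq_lof {k ι M : Type*} [Field k] [DecidableEq ι] [AddCommGroup M] [Module k M]
    {P : ι → Submodule k M} {i j : ι} (h : i = j) {x : P i} {y : P j} (hxy : x.1 = y.1) :
    DirectSum.lof k ι (fun i => P i) i x = DirectSum.lof k ι (fun i => P i) j y := by
  subst h
  rw [Subtype.ext hxy]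

/-- Graded `k`-algebras `⨁ A_l`, over `ℕ`, and `⨁ P_i` are isomorphic if the `P_i` outside the image of
`ℕ` vanish and there are isomorphisms of the other pieces compatible with the multiplication. -/
theorem exists_algEquiv_directSum {k V W ι : Type*} [Field k] [Ring V] [Algebra k V] [Ring W]
    [Algebra k W] [AddCommGroup ι] [DecidableEq ι] (A : ℕ → Submodule k V) [SetLike.GradedMonoid A]
    (P : ι → Submodule k W) [SetLike.GradedMonoid P] {φ : ℤ → ι} (hφ : Function.Bijective φ)
    (φ0 : φ 0 = 0) (φadd : ∀ m m', φ m + φ m' = φ (m + m')) (hneg : ∀ m < 0, P (φ m) = ⊥)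
    (e : ∀ l : ℕ, A l ≃ₗ[k] P (φ l))
    (h1 : (e 0 ⟨1, SetLike.GradedOne.one_mem⟩).1 = 1)
    (hmul : ∀ (l m : ℕ) (f : A l) (g : A m),
      (e (l + m) ⟨f.1 * g.1, SetLike.mul_mem_graded f.2 g.2⟩).1 = (e l f).1 * (e m g).1) :
    ∃ E : (⨁ l, A l) ≃ₐ[k] (⨁ i, P i), ∀ m : ℤ,
      (⨆ (l : ℕ) (_ : (l : ℤ) = m), LinearMap.range (DirectSum.lof k ℕ (fun l => A l) l)).map
        E.toLinearMap = LinearMap.range (DirectSum.lof k ι (fun i => P i) (φ m)) := by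
  let ψ : ∀ l : ℕ, A l →ₗ[k] ⨁ i, P i := fun l =>
    DirectSum.lof k _ (fun i => P i) (φ l) ∘ₗ (e l).toLinearMap
  let Φ : (⨁ l, A l) →ₐ[k] (⨁ i, P i) := DirectSum.toAlgebra k _ ψ
    (by
      refine (lof_eq_lof (P := P) (y := ⟨1, SetLike.GradedOne.one_mem⟩) φ0 h1).trans ?_
      rfl)
    (by
      intro l m f g
      refine Eq.trans ?_ (DirectSum.of_mul_of (A := fun i => P i) _ _).symm
      exact lof_eq_lof (P := P) (by rw [φadd]; push_cast; rfl) (hmul l m f g))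
  have hΦ : ∀ l f, Φ (DirectSum.lof k ℕ (fun l => A l) l f) =
      DirectSum.lof k _ (fun i => P i) (φ l) (e l f) := fun l f =>
    DirectSum.toAddMonoid_of (fun l => (ψ l).toAddMonoidHom) l f
  have hcomp : ∀ (l : ℕ) (x : ⨁ l, A l), Φ x (φ l) = e l (x l) := by
    intro l x
    induction x using DirectSum.induction_on with
    | zero => rw [map_zero, DirectSum.zero_apply, DirectSum.zero_apply, map_zero]
    | of m f =>
      refine (DFunLike.congr_fun (hΦ m f) _).trans ?_
      rcases eq_or_ne l m with rfl | hlm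
      · rw [DirectSum.of_eq_same]
        exact DirectSum.of_eq_same _ _
      · rw [DirectSum.of_eq_of_ne _ _ _ hlm, map_zero]
        exact DirectSum.of_eq_of_ne _ _ _ fun h => hlm (by exact_mod_cast hφ.1 h)
    | add x y hx hy => rw [map_add, DirectSum.add_apply, hx, hy, DirectSum.add_apply, map_add]
  have hinj : Function.Injective Φ := by
    rw [injective_iff_map_eq_zero]
    intro x hx
    refine DFinsupp.ext fun l => (e l).map_eq_zero_iff.1 ?_
    rw [← hcomp, hx, DirectSum.zero_apply]
  have hneg' : ∀ m < 0, ∀ z : P (φ m), z = 0 := fun m hm z =>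
    Subtype.ext ((Submodule.mem_bot k).1 ((hneg m hm).le z.2))
  have hlof : ∀ (m : ℕ) (z : P (φ m)), Φ (DirectSum.lof k ℕ (fun l => A l) m ((e m).symm z)) =
      DirectSum.lof k _ (fun i => P i) (φ m) z := fun m z => by
    rw [hΦ, LinearEquiv.apply_symm_apply]
  have hsurj : Function.Surjective Φ := by
    intro z
    induction z using DirectSum.induction_on with
    | zero => exact ⟨0, map_zero _⟩
    | of i z =>
      obtain ⟨m, rfl⟩ := hφ.2 i
      rcases lt_or_ge m 0 with hm | hm
      · rw [hneg' m hm z, map_zero]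
        exact ⟨0, map_zero _⟩
      · lift m to ℕ using hm
        exact ⟨_, hlof m z⟩
    | add z w hz hw =>
      obtain ⟨x, rfl⟩ := hz
      obtain ⟨y, rfl⟩ := hw
      exact ⟨x + y, map_add _ _ _⟩
  refine ⟨AlgEquiv.ofBijective Φ ⟨hinj, hsurj⟩, fun m => ?_⟩
  apply le_antisymm
  · rw [Submodule.map_le_iff_le_comap]
    refine iSup₂_le ?_
    rintro l rfl _ ⟨f, rfl⟩
    exact ⟨e l f, (hΦ l f).symm⟩
  · rintro _ ⟨z, rfl⟩
    rcases lt_or_ge m 0 with hm | hm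
    · rw [hneg' m hm z, map_zero]
      exact zero_mem _
    · lift m to ℕ using hm
      exact ⟨DirectSum.lof k ℕ (fun l => A l) m ((e m).symm z),
        Submodule.mem_iSup_of_mem m (Submodule.mem_iSup_of_mem rfl ⟨_, rfl⟩), hlof m z⟩

variable {k : Type u} [Field k] {d n : ℕ} {coef : Fin n → Fin (d + 1) → k} {p : Fin n → ℕ}

section Roots

variable {Ω : Type u} [Field Ω] [Algebra k Ω] [Algebra (MvPolynomial (Fin (d + 1)) k) Ω]
  [IsScalarTower k (MvPolynomial (Fin (d + 1)) k) Ω] [FaithfulSMul (MvPolynomial (Fin (d + 1)) k) Ω]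
  {y : Fin n → Ω} (hy : ∀ i, y i ^ p i = algebraMap _ Ω (linearForm coef i))

theorem eq_of_conjMatrix_eq (hℓ : ∀ i, linearForm coef i ≠ 0) (hy0 : ∀ i, y i ≠ 0) {l : ℕ}
    {M N : Matrix (Idx p) (Idx p) (GLRing p coef)} (hM : M ∈ glPiece coef p l)
    (hN : N ∈ glPiece coef p l) (h : conjMatrix coef p hy M = conjMatrix coef p hy N) : M = N :=
  congrArg Subtype.val (@conjMatrix_injective _ _ _ _ coef p _ _ _ y _ _ hy _ hℓ hy0 l
    ⟨M, hM⟩ ⟨N, hN⟩ h)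

theorem exists_linearEquiv (hd : 1 ≤ d) (hℓ : ∀ i, linearForm coef i ≠ 0) (hy0 : ∀ i, y i ≠ 0)
    (l : ℕ) : ∃ e : H0 coef p l ≃ₗ[k] glPiece coef p l,
      ∀ f, conjMatrix coef p hy (e f).1 = sectionMatrix coef p Ω l f := by
  obtain ⟨e, he⟩ := exists_linearEquiv_of_range_eq (sectionMatrix_injective coef p Ω hℓ l)
    (conjMatrix_injective coef p hy hℓ hy0 l)
    ((range_sectionMatrix coef p Ω hd hℓ l).trans (range_conjMatrix coef p hy hℓ hy0 l).symm)
  exact ⟨e, he⟩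

theorem sectionMatrix_one :
    sectionMatrix coef p Ω 0 ⟨1, SetLike.GradedOne.one_mem⟩ = 1 :=
  (sectionMatrix_apply coef p Ω _).trans (map_one (genericMatrix coef p Ω))

theorem one_mem_glPiece_natCast : 1 ∈ glPiece coef p ((0 : ℕ) : ℤ) := by
  rw [Nat.cast_zero]
  exact one_mem_glPiece coef p

theorem mul_mem_glPiece_natCast {l m : ℕ} {M N : Matrix (Idx p) (Idx p) (GLRing p coef)}
    (hM : M ∈ glPiece coef p l) (hN : N ∈ glPiece coef p m) :
    M * N ∈ glPiece coef p ((l + m : ℕ) : ℤ) := by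
  rw [Nat.cast_add]
  exact mul_mem_glPiece coef p hM hN

/-- Over a field containing all `p_i`-th roots of the `ℓ_i`, both sides become the same graded ring of
matrices of forms. -/
theorem exists_algEquiv_of_roots (hy : ∀ i, y i ^ p i = algebraMap _ Ω (linearForm coef i))
    (hd : 1 ≤ d) (hp : ∀ i, 1 ≤ p i) (hℓ : ∀ i, linearForm coef i ≠ 0) :
    ∃ e : B coef p ≃ₐ[k] GLRegrade p coef,
      ∀ m : ℤ, (degB coef p m).map e.toLinearMap = degGLRegrade p coef m := by
  have hy0 : ∀ i, y i ≠ 0 := by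
    intro i h
    have h1 := hy i
    rw [h, zero_pow (Nat.one_le_iff_ne_zero.1 (hp i)), eq_comm,
      FaithfulSMul.algebraMap_eq_zero_iff] at h1
    exact hℓ i h1
  choose e he using exists_linearEquiv hy hd hℓ hy0
  refine exists_algEquiv_directSum (H0 coef p) (regradePiece (glGrading p coef)
    (AddSubgroup.zmultiples (cvec p)) (stdRep p)) ⟨degIdx_injective p hp, degIdx_surjective p⟩
    (degIdx_zero p) (degIdx_add p) (fun m hm => glPiece_eq_bot coef p hm) e ?_ fun l m f g => ?_
  · refine eq_of_conjMatrix_eq hy hℓ hy0 (e 0 _).2 one_mem_glPiece_natCast ?_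
    exact (he 0 _).trans (sectionMatrix_one.trans (conjMatrix_one coef p hy hy0).symm)
  · refine eq_of_conjMatrix_eq hy hℓ hy0 (e (l + m) _).2
      (mul_mem_glPiece_natCast (e l f).2 (e m g).2) ?_
    exact ((he (l + m) _).trans (sectionMatrix_mul coef p Ω f g _ rfl)).trans
      ((congrArg₂ (· * ·) (he l f) (he m g)).symm.trans (conjMatrix_mul coef p hy hy0 _ _).symm)

end Roots

/-- General position, applied to a single hyperplane, says that it has codimension one. -/
theorem linearForm_ne_zero (hL : GeneralPosition coef) (i : Fin n) : linearForm coef i ≠ 0 := by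
  intro h
  have hcoef : ∀ j, coef i j = 0 := by
    intro j
    have := congrArg (MvPolynomial.coeff (Finsupp.single j 1)) h
    simpa [linearForm, MvPolynomial.coeff_sum, MvPolynomial.coeff_C_mul, MvPolynomial.coeff_X,
      Finsupp.single_left_inj] using this
  have h1 := hL {i}
  have h2 : (Matrix.of fun (i' : ({i} : Finset (Fin n))) (j : Fin (d + 1)) => coef i' j) = 0 := by
    ext ⟨i', hi'⟩ j
    obtain rfl := Finset.mem_singleton.1 hi'
    exact hcoef j
  rw [h2, Matrix.mulVecLin_zero, LinearMap.ker_zero, finrank_top, Module.finrank_fin_fun,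
    Finset.card_singleton] at h1
  omega

end Comparison

end GLOrder

end

theorem proposition3p5 {k : Type*} [Field k] {d n : ℕ} (hd : 1 ≤ d)
    (coef : Fin n → Fin (d + 1) → k) (hL : GLOrder.GeneralPosition coef)
    (p : Fin n → ℕ) (hp : ∀ i, 1 ≤ p i) :
    ∃ e : GLOrder.B coef p ≃ₐ[k] GLOrder.GLRegrade p coef,
      ∀ m : ℤ, (GLOrder.degB coef p m).map e.toLinearMap = GLOrder.degGLRegrade p coef m := by
  let K := FractionRing (MvPolynomial (Fin (d + 1)) k)
  have : FaithfulSMul (MvPolynomial (Fin (d + 1)) k) (AlgebraicClosure K) := by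
    rw [faithfulSMul_iff_algebraMap_injective, IsScalarTower.algebraMap_eq _ K]
    exact (algebraMap K (AlgebraicClosure K)).injective.comp
      (IsFractionRing.injective (MvPolynomial (Fin (d + 1)) k) K)
  choose y hy using fun i => IsAlgClosed.exists_pow_nat_eq (algebraMap (MvPolynomial (Fin (d + 1)) k)
    (AlgebraicClosure K) (GLOrder.linearForm coef i)) (hp i)
  exact GLOrder.exists_algEquiv_of_roots hy hd hp (GLOrder.linearForm_ne_zero hL)
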